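/- **Setting.** Let $[p]=\{1,\dots,p\}$. Graphs have vertex set $[p]$ and are given by a set $E$ of ordered pairs of distinct vertices; write $a\to b$ (arrow) if $(a,b)\in E$, $(b,a)\notin E$, and $a - b$ (line) if both pairs are in $E$. Two vertices are adjacent if they are joined by an arrow or a line; $G\subset H$ means inclusion of edge sets; $G\pm(a,b)$ denotes insertion/removal of the ordered pair $(a,b)$; $\mathrm{nb}_G(v)=\{a: a - v\in G\}$; the skeleton of $G$ is the undirected graph with the same adjacencies. A DAG is a directed graph without cycles; $\mathrm{pa}_D(a)=\{b : b\to a\in D\}$. $T_G(v)$, the chain component of $v$, is the set of all $b$ such that there are paths (following edges $(a_{i-1},a_i)\in E$) in $G$ from $v$ to $b$ and from $b$ to $v$. An ordering $(v_1,\dots,v_k)$ of the vertices of a graph is a perfect elimination ordering if for each $i$ the vertices among $v_1,\dots,v_{i-1}$ adjacent to $v_i$ are pairwise adjacent. For each $i\in[p]$ let $(\mathcal X_i,\mathcal A_i,\mu_i)$ be a $\sigma$-finite measure space having two disjoint measurable sets of positive measure, and let $\mu=\bigotimes_i\mu_i$ on $\mathcal X=\prod_i\mathcal X_i$. For a strictly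 positive probability density $f$ w.r.t. $\mu$ let $f(x_a\mid x_B)=f(x_{\{a\}\cup B})/f(x_B)$ denote the conditional densities (quotients of marginal densities). For a DAG $D$ let $\mathcal M(D)$ be the set of strictly positive densities with $f(x)=\prod_{i}f(x_i\mid x_{\mathrm{pa}_D(i)})$ $\mu$-a.e. Let $\mathcal I=(I_1,\dots,I_J)$, $I_j\subset[p]$, be a conservative family of targets, i.e. for every $a\in[p]$ there is a $j$ with $a\notin I_j$. Let $D^{(I)}$ be $D$ with all edges $(a,b)$, $b\in I$, removed, and let $\mathcal M_{\mathcal I}(D)$ be the set of tuples $(f^{(j)})_{j\le J}$ with $f^{(j)}\in\mathcal M(D^{(I_j)})$ for all $j$ and $f^{(j)}(x_a\mid x_{\mathrm{pa}_D(a)})=f^{(k)}(x_a\mid x_{\mathrm{pa}_D(a)})$ $\mu$-a.e. for all $j,k$ and all $a\notin I_j\cup I_k$. DAGs $D_1,D_2$ are $\mathcal I$-equivalent if $\mathcal M_{\mathcal I}(D_1)=\mathcal M_{\mathcal I}(D_2)$. The $\mathcal I$-essential graph $\mathcal E_{\mathcal I}(D)$ is the union of all DAGs $\mathcal I$-equivalent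 to $D$. A graph $H$ is a *partial $\mathcal I$-essential graph* of a DAG $D$ if $D\subset H\subset\mathcal E_{\mathcal I}(D)$ and $H$ has no induced subgraph of the form $a\to b - c$. Let $G$ be the $\mathcal I$-essential graph of some DAG. Let $\mathbf D(G)$ be the set of DAGs $D\subset G$ with the same skeleton as $G$ such that for every chain component $T$ of $G$ the induced subgraph $D[T]$ is oriented according to a perfect elimination ordering of $G[T]$. Let $\mathbf D^+(G)$ be the set of DAGs $D'$ having an arrow $u\to v$ with $D'-(u,v)\in\mathbf D(G)$; $\mathbf D^-(G)$ the set of DAGs obtained from some $D\in\mathbf D(G)$ by removing one arrow; and $\mathbf D^{\circlearrowleft}(G)$ the set of DAGs $D'\notin\mathbf D(G)$ having an arrow $u\to v$ with $D'-(u,v)+(v,u)\in\mathbf D(G)$. **Lemma.** 1. (Forward step.) Let $u\ne v$ be non-adjacent in $G$, $D\in\mathbf D(G)$, $C=\{a\in\mathrm{nb}_G(v): a\to v\in D\}$, and suppose $D'=D+(u,v)\in\mathbf D^+(G)$. Let $H$ be obtained from $G$ by orienting all edges inside $T_G(v)$ as in $D$ (leaving everything else unchanged) and inserting $(u,v)$.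 Then $H$ is a partial $\mathcal I$-essential graph of $D'$. 2. (Backward step.) Let $(u,v)$ be an edge of $G$ (that is, $u - v\in G$ or $u\to v\in G$), $D\in\mathbf D(G)$ with $u\to v\in D$, $C=\{a\in\mathrm{nb}_G(v)\setminus\{u\}: a\to v\in D\}$, and $D'=D-(u,v)\in\mathbf D^-(G)$. Let $H$ be obtained from $G$ by orienting all edges inside $T_G(v)$ as in $D$ and removing $(u,v)$. Then $H$ is a partial $\mathcal I$-essential graph of $D'$. 3. (Turning step, line of $G$.) Let $u - v\in G$, $C\subset\mathrm{nb}_G(v)\setminus\{u\}$, $D\in\mathbf D(G)$ with $v\to u\in D$ and $\{a\in\mathrm{nb}_G(v): a\to v\in D\}=C$, and suppose $D'=D-(v,u)+(u,v)\in\mathbf D^{\circlearrowleft}(G)$. Let $H$ be obtained from $G$ by orienting all edges inside $T_G(v)$ as in $D$ and replacing $v\to u$ by $u\to v$. Then $H$ is a partial $\mathcal I$-essential graph of $D'$. 4. (Turning step, arrow of $G$.) Let $v\to u\in G$, $D\in\mathbf D(G)$, $C=\{a\in\mathrm{nb}_G(v): a\to v\in D\}$, and suppose $D'=D-(v,u)+(u,v)\in\mathbf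 D^{\circlearrowleft}(G)$. Let $H$ be obtained from $G$ by orienting all edges inside $T_G(v)$ and all edges inside $T_G(u)$ as in $D$ and replacing $v\to u$ by $u\to v$. Then $H$ is a partial $\mathcal I$-essential graph of $D'$. -/

import Mathlib

open MeasureTheory
open scoped ENNReal

namespace IntervGraph

section Graphs

variable {V : Type*}

/- A graph is given by its set of ordered pairs `(a, b)`, i.e. by a `Digraph`. All graphs that
occur below are contained in essential graphs of acyclic graphs, so they have no loops. -/

/-- `a → b ∈ G`: the edge is present in this direction only. -/
def IsArrow (G : Digraph V) (a b : V) : Prop := G.Adj a b ∧ ¬ G.Adj b a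

/-- `a — b ∈ G`: the edge is present in both directions. -/
def IsLine (G : Digraph V) (a b : V) : Prop := G.Adj a b ∧ G.Adj b a

/-- `a` and `b` are joined by an edge of some kind. -/
def IsAdjacent (G : Digraph V) (a b : V) : Prop := G.Adj a b ∨ G.Adj b a

/-- The skeleton `G^u`. -/
def skeleton (G : Digraph V) : Digraph V where
  Adj a b := IsAdjacent G a b

/-- The neighbors of `a`, i.e. the vertices joined to `a` by a line. -/
def nb (G : Digraph V) (a : V) : Set V := {b | IsLine G a b}

/-- The induced subgraph `G[T]`. -/
def induced (G : Digraph V) (T : Set V) : Digraph T where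
  Adj a b := G.Adj a b

/-- `G + (a, b)`. -/
def addEdge (G : Digraph V) (a b : V) : Digraph V where
  Adj x y := G.Adj x y ∨ (x = a ∧ y = b)

/-- `G - (a, b)`. -/
def removeEdge (G : Digraph V) (a b : V) : Digraph V where
  Adj x y := G.Adj x y ∧ ¬ (x = a ∧ y = b)

/-- A directed acyclic graph: no vertex can be reached from itself by a nonempty sequence of
edges. (A loop or a line would be such a sequence, so all edges of `D` are arrows.) -/
def IsDAG (D : Digraph V) : Prop := ∀ a, ¬ Relation.TransGen D.Adj a a

/-- The preorder `a ≼ b`: there is a path (of length at least `0`) from `a` to `b`. -/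
def Precedes (G : Digraph V) (a b : V) : Prop := Relation.ReflTransGen G.Adj a b

/-- The chain component `T_G(a)`, the class of `a` for `a ≼ b ∧ b ≼ a`. -/
def chainComponent (G : Digraph V) (a : V) : Set V := {b | Precedes G a b ∧ Precedes G b a}

/-- The ordering `σ` is a perfect elimination ordering of `G`: the vertices that precede `σ i`
and are adjacent to it in the skeleton of `G` are pairwise adjacent. -/
def IsPerfectEliminationOrdering (G : Digraph V) (σ : Fin (Nat.card V) ≃ V) : Prop :=
  ∀ i j k, j < i → k < i → j ≠ k → IsAdjacent G (σ j) (σ i) → IsAdjacent G (σ k) (σ i) →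
    IsAdjacent G (σ j) (σ k)

/-- `D` is oriented according to the ordering `σ`. -/
def IsOrientedAccordingTo (D : Digraph V) (σ : Fin (Nat.card V) ≃ V) : Prop :=
  ∀ a b, D.Adj a b → σ.symm a < σ.symm b

/-- The set `𝐃(G)` of representatives of an essential graph `G`. -/
def representatives (G : Digraph V) : Set (Digraph V) :=
  {D | IsDAG D ∧ D ≤ G ∧ skeleton D = skeleton G ∧
    ∀ a : V, ∃ σ : Fin (Nat.card (chainComponent G a)) ≃ chainComponent G a,
      IsPerfectEliminationOrdering (induced G (chainComponent G a)) σ ∧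
      IsOrientedAccordingTo (induced D (chainComponent G a)) σ}

/-- `𝐃⁺(G)`: the DAGs from which a representative arises by removing one arrow. -/
def forwardDAGs (G : Digraph V) : Set (Digraph V) :=
  {D' | IsDAG D' ∧ ∃ u v, IsArrow D' u v ∧ removeEdge D' u v ∈ representatives G}

/-- `𝐃⁻(G)`: the DAGs obtained by removing one arrow of a representative. -/
def backwardDAGs (G : Digraph V) : Set (Digraph V) :=
  {D' | IsDAG D' ∧ ∃ D ∈ representatives G, ∃ u v, IsArrow D u v ∧ D' = removeEdge D u v}

/-- `𝐃^↺(G)`: the DAGs that are not representatives, but become one by turning one arrow. -/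
def turningDAGs (G : Digraph V) : Set (Digraph V) :=
  {D' | IsDAG D' ∧ D' ∉ representatives G ∧
    ∃ u v, IsArrow D' u v ∧ addEdge (removeEdge D' u v) v u ∈ representatives G}

/-- The graph obtained from `G` by orienting all edges inside `T` as in `D`. -/
def orientAs (G D : Digraph V) (T : Set V) : Digraph V where
  Adj a b := (a ∈ T ∧ b ∈ T ∧ D.Adj a b) ∨ (¬ (a ∈ T ∧ b ∈ T) ∧ G.Adj a b)

/-- The intervention graph `D^(I)`. -/
def interventionGraph (D : Digraph V) (I : Finset V) : Digraph V where
  Adj a b := D.Adj a b ∧ b ∉ I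

/-- A family of targets is conservative if every vertex is avoided by some target. -/
def IsConservative {ι : Type*} (𝓘 : ι → Finset V) : Prop := ∀ a, ∃ j, a ∉ 𝓘 j

open Classical in
/-- The set of parents of `a`. -/
noncomputable def pa [Fintype V] (G : Digraph V) (a : V) : Finset V :=
  Finset.univ.filter fun b => IsArrow G b a

end Graphs

section Densities

variable {V : Type*} [Fintype V] [DecidableEq V] {Ω : V → Type*} [∀ i, MeasurableSpace (Ω i)]
  (μ : ∀ i, Measure (Ω i))

/-- Strictly positive probability densities on `∏ i, Ω i` with respect to the product measure. -/
def IsPositiveDensity (f : (∀ i, Ω i) → ℝ≥0∞) : Prop :=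
  Measurable f ∧ (∀ x, 0 < f x ∧ f x < ∞) ∧ ∫⁻ x, f x ∂(Measure.pi μ) = 1

/-- The marginal density `f(x_A)`; all variables outside `A` are integrated out. -/
noncomputable def marginalDensity (f : (∀ i, Ω i) → ℝ≥0∞) (A : Finset V) : (∀ i, Ω i) → ℝ≥0∞ :=
  ∫⋯∫⁻_Aᶜ, f ∂μ

/-- The conditional density `f(x_a | x_B)`. -/
noncomputable def condDensity (f : (∀ i, Ω i) → ℝ≥0∞) (a : V) (B : Finset V) (x : ∀ i, Ω i) :
    ℝ≥0∞ :=
  marginalDensity μ f (insert a B) x / marginalDensity μ f B x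

/-- `𝓜(D)`: the positive densities that obey the Markov property of `D`. -/
def markovDensities (D : Digraph V) : Set ((∀ i, Ω i) → ℝ≥0∞) :=
  {f | IsPositiveDensity μ f ∧
    f =ᵐ[Measure.pi μ] fun x => ∏ i, condDensity μ f i (pa D i) x}

/-- `𝓜_𝓘(D)`: the tuples of interventional densities, indexed by the family of targets `𝓘`. -/
def interventionalDensities {ι : Type*} (𝓘 : ι → Finset V) (D : Digraph V) :
    Set (ι → (∀ i, Ω i) → ℝ≥0∞) :=
  {f | (∀ j, f j ∈ markovDensities μ (interventionGraph D (𝓘 j))) ∧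
    ∀ j k a, a ∉ 𝓘 j → a ∉ 𝓘 k →
      condDensity μ (f j) a (pa D a) =ᵐ[Measure.pi μ] condDensity μ (f k) a (pa D a)}

/-- Interventional Markov equivalence `D₁ ∼_𝓘 D₂`. -/
def MarkovEquivalent {ι : Type*} (𝓘 : ι → Finset V) (D₁ D₂ : Digraph V) : Prop :=
  interventionalDensities μ 𝓘 D₁ = interventionalDensities μ 𝓘 D₂

/-- The `𝓘`-essential graph of `D`: the union of all DAGs equivalent to `D`. -/
def essentialGraph {ι : Type*} (𝓘 : ι → Finset V) (D : Digraph V) : Digraph V :=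
  sSup {D' | IsDAG D' ∧ MarkovEquivalent μ 𝓘 D' D}

/-- `G` is the `𝓘`-essential graph of some DAG. -/
def IsEssentialGraph {ι : Type*} (𝓘 : ι → Finset V) (G : Digraph V) : Prop :=
  ∃ D, IsDAG D ∧ G = essentialGraph μ 𝓘 D

/-- `G` is a partial `𝓘`-essential graph of the DAG `D`: it lies between `D` and the essential
graph of `D` and has no induced subgraph `a → b — c`. -/
def IsPartialEssentialGraph {ι : Type*} (𝓘 : ι → Finset V) (D G : Digraph V) : Prop :=
  IsDAG D ∧ D ≤ G ∧ G ≤ essentialGraph μ 𝓘 D ∧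
    ¬ ∃ a b c, IsArrow G a b ∧ IsLine G b c ∧ ¬ IsAdjacent G a c

end Densities

end IntervGraph

open IntervGraph

/-!
For strictly positive densities the Markov property and the agreement of conditional densities are
determined by the combinatorics of the DAG: `D₁` and `D₂` are `𝓘`-equivalent if and only if they
have the same adjacencies and v-structures and every target contains both or none of the end points
of an edge on which they disagree. Equivalent graphs are joined by a chain of reversals of covered
edges, and each reversal preserves the densities; conversely, a density whose variables are
correlated through a parity on a vertex and its parents separates graphs that are not equivalent.

Consequently a DAG obtained from two representatives of an essential graph `G` by using one of them
inside a union of chain components and the other elsewhere is again a representative. In each of the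
four steps, every edge of `H` other than the edge that is inserted or turned thus belongs to a
representative `E` that gives the reoriented vertices the same parents as `D`. The step applied to
`E` yields a graph with the same skeleton and v-structures as `D'`. It is acyclic: a directed path
of `E` closing a cycle can be rerouted to a path of `D`, because an arrow `a → x` of `G` followed by
a line `x - y` can be replaced by an edge from `a` to `y`.
-/

namespace IntervGraph

section Marginals

open Function

variable {V : Type*} [DecidableEq V] {Ω : V → Type*} [∀ i, MeasurableSpace (Ω i)]
  {μ : ∀ i, Measure (Ω i)} [∀ i, SigmaFinite (μ i)]

theorem lmarginal_pos (hμ : ∀ i, μ i ≠ 0) {f : (∀ i, Ω i) → ℝ≥0∞} (hf : Measurable f)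
    (hpos : ∀ x, 0 < f x) (s : Finset V) (x : ∀ i, Ω i) : 0 < (∫⋯∫⁻_s, f ∂μ) x := by
  have hsupport : support (fun y : ∀ i : s, Ω i => f (updateFinset x s y)) = Set.univ :=
    Set.eq_univ_of_forall fun y => (hpos _).ne'
  rw [lmarginal, lintegral_pos_iff_support (by fun_prop), hsupport, Measure.pi_univ,
    pos_iff_ne_zero, Finset.prod_ne_zero_iff]
  exact fun i _ => Measure.measure_univ_ne_zero.2 (hμ i)

variable [Fintype V]

theorem ae_pi_of_forall_ae_updateFinset {P : (∀ i, Ω i) → Prop} (hP : MeasurableSet {x | P x})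
    (s : Finset V)
    (h : ∀ x, ∀ᵐ y ∂Measure.pi fun i : s => μ i, P (updateFinset x s y)) :
    ∀ᵐ x ∂Measure.pi μ, P x := by
  have hI : Measurable ({x | P x}ᶜ.indicator (1 : (∀ i, Ω i) → ℝ≥0∞)) :=
    measurable_one.indicator hP.compl
  have hzero : ∫⋯∫⁻_s, {x | P x}ᶜ.indicator 1 ∂μ = ∫⋯∫⁻_s, 0 ∂μ := by
    funext x
    refine lintegral_congr_ae ?_
    filter_upwards [h x] with y hy
    simp [hy]
  change Measure.pi μ {x | P x}ᶜ = 0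
  rw [← lintegral_indicator_one hP.compl, lintegral_eq_of_lmarginal_eq s hI measurable_zero hzero]
  exact lintegral_zero

theorem ae_ae_updateFinset_of_ae {P : (∀ i, Ω i) → Prop} (h : ∀ᵐ x ∂Measure.pi μ, P x)
    (s : Finset V) :
    ∀ᵐ x ∂Measure.pi μ, ∀ᵐ y ∂Measure.pi fun i : s => μ i, P (updateFinset x s y) := by
  obtain ⟨N, hPN, hN, hN0⟩ := exists_measurable_superset_of_null (ae_iff.1 h)
  have hI : Measurable (N.indicator (1 : (∀ i, Ω i) → ℝ≥0∞)) := measurable_one.indicator hN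
  have hzero : ∫⁻ x, (∫⋯∫⁻_s, N.indicator 1 ∂μ) x ∂Measure.pi μ = 0 := by
    have hcompl : ∫⋯∫⁻_sᶜ, ∫⋯∫⁻_s, N.indicator 1 ∂μ ∂μ = ∫⋯∫⁻_sᶜ, 0 ∂μ := by
      funext x
      rw [← lmarginal_union μ _ hI disjoint_compl_left, Finset.union_comm, Finset.union_compl,
        lmarginal_univ, lintegral_indicator_one hN, hN0]
      exact lintegral_zero.symm
    rw [lintegral_eq_of_lmarginal_eq sᶜ (hI.lmarginal μ) measurable_zero hcompl]
    exact lintegral_zero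
  filter_upwards [(lintegral_eq_zero_iff (hI.lmarginal μ)).1 hzero] with x hx
  filter_upwards [(lintegral_eq_zero_iff (hI.comp measurable_updateFinset)).1 hx] with y hy
  by_contra hPy
  simp [show updateFinset x s y ∈ N from hPN hPy] at hy

theorem lmarginal_ae_congr {f g : (∀ i, Ω i) → ℝ≥0∞} (h : f =ᵐ[Measure.pi μ] g) (s : Finset V) :
    ∫⋯∫⁻_s, f ∂μ =ᵐ[Measure.pi μ] ∫⋯∫⁻_s, g ∂μ := by
  filter_upwards [ae_ae_updateFinset_of_ae h s] with x hx
  exact lintegral_congr_ae hx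

theorem lmarginal_ae_lt_top {f : (∀ i, Ω i) → ℝ≥0∞} (hf : Measurable f)
    (h : ∫⁻ x, f x ∂Measure.pi μ ≠ ∞) (s : Finset V) :
    ∀ᵐ x ∂Measure.pi μ, (∫⋯∫⁻_s, f ∂μ) x < ∞ := by
  have hm : Measurable (∫⋯∫⁻_s, f ∂μ) := hf.lmarginal μ
  refine ae_pi_of_forall_ae_updateFinset (measurableSet_lt hm measurable_const) sᶜ fun x => ?_
  refine ae_lt_top (hm.comp measurable_updateFinset) (ne_of_eq_of_ne ?_ h)
  change (∫⋯∫⁻_sᶜ, ∫⋯∫⁻_s, f ∂μ ∂μ) x = _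
  rw [← lmarginal_union μ f hf disjoint_compl_left, Finset.union_comm, Finset.union_compl,
    lmarginal_univ]

end Marginals

/-! ### Acyclic graphs and covered edges -/

section AcyclicGraphs

variable {V : Type*} {D : Digraph V}

theorem IsDAG.not_adj_self (hD : IsDAG D) (a : V) : ¬ D.Adj a a :=
  fun h => hD a (.single h)

theorem IsDAG.ne (hD : IsDAG D) {a b : V} (h : D.Adj a b) : a ≠ b := by
  rintro rfl
  exact hD.not_adj_self a h

theorem IsDAG.not_adj (hD : IsDAG D) {a b : V} (h : D.Adj a b) : ¬ D.Adj b a :=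
  fun h' => hD a (.trans (.single h) (.single h'))

theorem IsDAG.not_adj_of_adj_of_adj (hD : IsDAG D) {a b c : V} (h : D.Adj a b)
    (h' : D.Adj b c) : ¬ D.Adj c a :=
  fun h'' => hD a (.trans (.trans (.single h) (.single h')) (.single h''))

theorem IsDAG.of_le (hD : IsDAG D) {D' : Digraph V} (h : D' ≤ D) : IsDAG D' :=
  fun a ha => hD a (Relation.TransGen.mono (fun _ _ h' => h h') a a ha)

theorem Precedes.mono {E : Digraph V} {a b : V} (h : D ≤ E) (hab : Precedes D a b) :
    Precedes E a b :=
  Relation.ReflTransGen.mono (fun _ _ h' => h h') _ _ hab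

theorem removeEdge_le (D : Digraph V) (u v : V) : removeEdge D u v ≤ D := fun _ _ h => h.1

theorem interventionGraph_le (D : Digraph V) (I : Finset V) : interventionGraph D I ≤ D :=
  fun _ _ h => h.1

theorem transGen_or_of_transGen_addEdge {u v a b : V}
    (h : Relation.TransGen (addEdge D u v).Adj a b) :
    Relation.TransGen D.Adj a b ∨ (Precedes D a u ∧ Precedes D v b) := by
  induction h with
  | single h =>
    rcases h with h | ⟨rfl, rfl⟩
    · exact .inl (.single h)
    · exact .inr ⟨.refl, .refl⟩
  | tail _ h ih =>
    rcases h with h | ⟨rfl, rfl⟩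
    · exact ih.imp (·.tail h) fun h' => ⟨h'.1, h'.2.tail h⟩
    · exact .inr ⟨ih.elim (·.to_reflTransGen) And.left, .refl⟩

theorem IsDAG.addEdge (hD : IsDAG D) {u v : V} (h : ¬ Precedes D v u) : IsDAG (addEdge D u v) :=
  fun a ha => (transGen_or_of_transGen_addEdge ha).elim (hD a) fun h' => h (h'.2.trans h'.1)

theorem IsDAG.not_precedes_of_addEdge {u v : V} (h : IsDAG (IntervGraph.addEdge D u v)) :
    ¬ Precedes D v u :=
  fun hvu => h u (.head' (.inr ⟨rfl, rfl⟩) (hvu.mono fun _ _ => .inl))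

theorem IsDAG.wellFounded [Finite V] (hD : IsDAG D) : WellFounded (Relation.TransGen D.Adj) :=
  have : Std.Irrefl (Relation.TransGen D.Adj) := ⟨hD⟩
  Finite.wellFounded_of_trans_of_irrefl _

theorem IsDAG.wellFounded_swap [Finite V] (hD : IsDAG D) :
    WellFounded (Function.swap (Relation.TransGen D.Adj)) :=
  have : Std.Irrefl (Function.swap (Relation.TransGen D.Adj)) := ⟨hD⟩
  Finite.wellFounded_of_trans_of_irrefl _

variable [Fintype V]

theorem mem_pa {a b : V} : b ∈ pa D a ↔ IsArrow D b a := by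
  simp [pa]

theorem notMem_pa (D : Digraph V) (a : V) : a ∉ pa D a :=
  fun h => (mem_pa.1 h).2 (mem_pa.1 h).1

theorem IsDAG.mem_pa_iff (hD : IsDAG D) {a b : V} : b ∈ pa D a ↔ D.Adj b a :=
  mem_pa.trans (and_iff_left_of_imp hD.not_adj)

end AcyclicGraphs

section CoveredEdges

variable {V : Type*} {D : Digraph V} {x y : V}

/-- `D` with the edge from `x` to `y` turned, i.e. `D - (x, y) + (y, x)`. -/
def turnEdge (D : Digraph V) (x y : V) : Digraph V := addEdge (removeEdge D x y) y x

theorem turnEdge_adj {a b : V} :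
    (turnEdge D x y).Adj a b ↔ (D.Adj a b ∧ ¬ (a = x ∧ b = y)) ∨ (a = y ∧ b = x) := Iff.rfl

theorem isAdjacent_turnEdge_iff (h : D.Adj x y) (a b : V) :
    IsAdjacent (turnEdge D x y) a b ↔ IsAdjacent D a b := by
  simp only [IsAdjacent, turnEdge_adj]
  grind

theorem turnEdge_turnEdge (h : IsArrow D x y) : turnEdge (turnEdge D x y) y x = D := by
  ext a b
  simp only [IsArrow, turnEdge_adj] at h ⊢
  grind

theorem interventionGraph_turnEdge_of_mem {I : Finset V} (hx : x ∈ I) (hy : y ∈ I) :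
    interventionGraph (turnEdge D x y) I = interventionGraph D I := by
  ext a b
  simp only [interventionGraph, turnEdge_adj]
  grind

theorem interventionGraph_turnEdge_of_notMem {I : Finset V} (hx : x ∉ I) :
    interventionGraph (turnEdge D x y) I = turnEdge (interventionGraph D I) x y := by
  ext a b
  simp only [interventionGraph, turnEdge_adj]
  grind

/-- The edge `x → y` of `D` is covered: apart from `x`, the vertices `x` and `y` have the same
parents. -/
structure IsCovered (D : Digraph V) (x y : V) : Prop where
  adj : D.Adj x y
  adj_iff : ∀ z, z ≠ x → (D.Adj z y ↔ D.Adj z x)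

theorem IsCovered.interventionGraph (h : IsCovered D x y) {I : Finset V} (hx : x ∉ I)
    (hy : y ∉ I) : IsCovered (interventionGraph D I) x y where
  adj := ⟨h.adj, hy⟩
  adj_iff z hz := by simp [IntervGraph.interventionGraph, h.adj_iff z hz, hx, hy]

theorem IsCovered.turnEdge (hD : IsDAG D) (h : IsCovered D x y) :
    IsCovered (turnEdge D x y) y x where
  adj := .inr ⟨rfl, rfl⟩
  adj_iff z hz := by
    have hne := hD.ne h.adj
    have hx := hD.not_adj_self x
    have := h.adj_iff z
    simp only [turnEdge_adj]
    grind

theorem IsCovered.isDAG_turnEdge (hD : IsDAG D) (h : IsCovered D x y) :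
    IsDAG (IntervGraph.turnEdge D x y) := by
  refine (hD.of_le (removeEdge_le D x y)).addEdge fun hpath => ?_
  rcases Relation.ReflTransGen.cases_tail hpath with rfl | ⟨z, hxz, hzy⟩
  · exact hD.not_adj_self _ h.adj
  · have hzx : D.Adj z x := (h.adj_iff z fun hz => hzy.2 ⟨hz, rfl⟩).1 hzy.1
    exact hD x (.tail' (Precedes.mono (removeEdge_le D x y) hxz) hzx)

section Parents

variable [Fintype V]

theorem pa_turnEdge_of_ne {c : V} (hx : c ≠ x) (hy : c ≠ y) : pa (turnEdge D x y) c = pa D c := by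
  ext z
  simp [mem_pa, IsArrow, turnEdge_adj, hx, hy]

theorem IsCovered.pa_eq_insert [DecidableEq V] (hD : IsDAG D) (h : IsCovered D x y) :
    pa D y = insert x (pa D x) := by
  ext z
  have := h.adj
  have := h.adj_iff z
  rw [Finset.mem_insert, hD.mem_pa_iff, hD.mem_pa_iff]
  grind

theorem IsCovered.pa_turnEdge (hD : IsDAG D) (h : IsCovered D x y) :
    pa (IntervGraph.turnEdge D x y) y = pa D x := by
  ext z
  have hne := hD.ne h.adj
  have hx := hD.not_adj_self x
  have := h.adj_iff z
  rw [(h.isDAG_turnEdge hD).mem_pa_iff, hD.mem_pa_iff, turnEdge_adj]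
  grind

end Parents

/-- `a → b ← c` is a v-structure: an induced subgraph with nonadjacent `a` and `c`. -/
def IsVStructure (D : Digraph V) (a b c : V) : Prop :=
  D.Adj a b ∧ D.Adj c b ∧ a ≠ c ∧ ¬ IsAdjacent D a c

theorem IsCovered.isVStructure_turnEdge_iff (hD : IsDAG D) (h : IsCovered D x y) (a b c : V) :
    IsVStructure (IntervGraph.turnEdge D x y) a b c ↔ IsVStructure D a b c := by
  have hcov := h.adj_iff
  have hadj := h.adj
  have := hD.not_adj hadj
  have hne := hD.ne hadj
  simp only [IsVStructure, isAdjacent_turnEdge_iff h.adj]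
  simp only [IsAdjacent, turnEdge_adj]
  grind

end CoveredEdges

/-! ### Graphical equivalence -/

section GraphEquivalence

variable {V ι : Type*} {𝓘 : ι → Finset V} {D₁ D₂ : Digraph V}

/-- The combinatorial counterpart of interventional Markov equivalence: the same skeleton, the same
v-structures, and every target contains both or none of the end points of an edge on whose
direction the two graphs disagree. -/
structure GraphEquivalent (𝓘 : ι → Finset V) (D₁ D₂ : Digraph V) : Prop where
  isAdjacent_iff : ∀ a b, IsAdjacent D₁ a b ↔ IsAdjacent D₂ a b
  isVStructure_iff : ∀ a b c, IsVStructure D₁ a b c ↔ IsVStructure D₂ a b c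
  mem_iff : ∀ a b, D₁.Adj a b → D₂.Adj b a → ∀ j, a ∈ 𝓘 j ↔ b ∈ 𝓘 j

theorem GraphEquivalent.eq_of_forall_adj (hD₂ : IsDAG D₂) (h : GraphEquivalent 𝓘 D₁ D₂)
    (hadj : ∀ a b, D₁.Adj a b → ¬ D₂.Adj b a) : D₁ = D₂ := by
  ext a b
  have hskel := h.isAdjacent_iff a b
  have hab := hadj a b
  have hba := hadj b a
  have hanti : D₂.Adj a b → ¬ D₂.Adj b a := hD₂.not_adj
  simp only [IsAdjacent] at hskel
  tauto

theorem GraphEquivalent.turnEdge (hD₁ : IsDAG D₁) (hD₂ : IsDAG D₂) (h : GraphEquivalent 𝓘 D₁ D₂)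
    {x y : V} (hxy : IsCovered D₁ x y) (hyx : D₂.Adj y x) :
    GraphEquivalent 𝓘 (turnEdge D₁ x y) D₂ where
  isAdjacent_iff a b := by rw [isAdjacent_turnEdge_iff hxy.adj, h.isAdjacent_iff]
  isVStructure_iff a b c := by rw [hxy.isVStructure_turnEdge_iff hD₁, h.isVStructure_iff]
  mem_iff a b hab hba := by
    rcases hab with ⟨hab, -⟩ | ⟨rfl, rfl⟩
    · exact h.mem_iff a b hab hba
    · exact absurd hba (hD₂.not_adj hyx)

theorem GraphEquivalent.exists_isCovered [Finite V] (hD₁ : IsDAG D₁) (hD₂ : IsDAG D₂)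
    (h : GraphEquivalent 𝓘 D₁ D₂) (hne : D₁ ≠ D₂) : ∃ x y, IsCovered D₁ x y ∧ D₂.Adj y x := by
  have hdis : {b | ∃ a, D₁.Adj a b ∧ D₂.Adj b a}.Nonempty := by
    contrapose! hne
    exact h.eq_of_forall_adj hD₂ fun a b hab hba =>
      Set.eq_empty_iff_forall_notMem.1 hne b ⟨a, hab, hba⟩
  -- Among the edges on which the graphs disagree, take one with a minimal head `y`, and among
  -- those with head `y` one with a maximal tail `x`.
  obtain ⟨y, hy, hymin⟩ := hD₁.wellFounded.has_min _ hdis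
  obtain ⟨x, ⟨hxy, hyx⟩, hxmax⟩ := hD₁.wellFounded_swap.has_min {a | D₁.Adj a y ∧ D₂.Adj y a} hy
  have hmin : ∀ a b, D₁.Adj a b → D₁.Adj b y → D₂.Adj a b := fun a b hab hby =>
    ((h.isAdjacent_iff a b).1 (.inl hab)).resolve_right fun hba =>
      hymin b ⟨a, hab, hba⟩ (.single hby)
  have hmax : ∀ z, D₁.Adj x z → D₁.Adj z y → D₂.Adj z y := fun z hxz hzy =>
    ((h.isAdjacent_iff z y).1 (.inl hzy)).resolve_right fun hyz => hxmax z ⟨hzy, hyz⟩ (.single hxz)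
  refine ⟨x, y, ⟨hxy, fun z hzx => ⟨fun hzy => ?_, fun hzx' => ?_⟩⟩, hyx⟩
  · have hadj : IsAdjacent D₁ z x := by
      by_contra hn
      exact hD₂.not_adj hyx ((h.isVStructure_iff z y x).1 ⟨hzy, hxy, hzx, hn⟩).2.1
    exact hadj.resolve_right fun hxz =>
      hD₂.not_adj_of_adj_of_adj (hmin x z hxz hzy) (hmax z hxz hzy) hyx
  · have hzy : z ≠ y := fun e => hD₁.not_adj hxy (e ▸ hzx')
    have hadj : IsAdjacent D₁ z y := by
      by_contra hn
      exact hD₁.not_adj hxy ((h.isVStructure_iff z x y).2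
        ⟨hmin z x hzx' hxy, hyx, hzy, fun h' => hn ((h.isAdjacent_iff z y).2 h')⟩).2.1
    exact hadj.resolve_right fun hyz => hD₁.not_adj_of_adj_of_adj hxy hyz hzx'

theorem turnEdge_disagreement_ssubset (hD₁ : IsDAG D₁) (hD₂ : IsDAG D₂) {x y : V}
    (hxy : D₁.Adj x y) (hyx : D₂.Adj y x) :
    {e : V × V | (turnEdge D₁ x y).Adj e.1 e.2 ∧ D₂.Adj e.2 e.1} ⊂
      {e | D₁.Adj e.1 e.2 ∧ D₂.Adj e.2 e.1} := by
  refine (Set.ssubset_iff_of_subset ?_).2 ⟨(x, y), ⟨hxy, hyx⟩, ?_⟩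
  · rintro ⟨a, b⟩ ⟨⟨hab, -⟩ | ⟨rfl, rfl⟩, hba⟩
    · exact ⟨hab, hba⟩
    · exact absurd hba (hD₂.not_adj hyx)
  · simp [turnEdge_adj, hD₁.ne hxy]

theorem GraphEquivalent.induction_turnEdge [Finite V] {P : Digraph V → Prop} (hD₁ : IsDAG D₁)
    (hD₂ : IsDAG D₂) (h : GraphEquivalent 𝓘 D₁ D₂) (base : P D₂)
    (step : ∀ D x y, IsDAG D → IsCovered D x y → (∀ j, x ∈ 𝓘 j ↔ y ∈ 𝓘 j) →
      P (IntervGraph.turnEdge D x y) → P D) : P D₁ := by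
  induction hn : {e : V × V | D₁.Adj e.1 e.2 ∧ D₂.Adj e.2 e.1}.ncard using Nat.strong_induction_on
    generalizing D₁ with
  | _ n ih =>
  by_cases heq : D₁ = D₂
  · exact heq ▸ base
  obtain ⟨x, y, hxy, hyx⟩ := h.exists_isCovered hD₁ hD₂ heq
  refine step D₁ x y hD₁ hxy (h.mem_iff x y hxy.adj hyx) ?_
  exact ih _ (hn ▸ Set.ncard_lt_ncard (turnEdge_disagreement_ssubset hD₁ hD₂ hxy.adj hyx))
    (hxy.isDAG_turnEdge hD₁) (h.turnEdge hD₁ hD₂ hxy hyx) rfl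

end GraphEquivalence

/-! ### Conditional densities and covered edges -/

section CondDensity

variable {V : Type*} [Fintype V] [DecidableEq V] {Ω : V → Type*} [∀ i, MeasurableSpace (Ω i)]
  {μ : ∀ i, Measure (Ω i)} {f g : (∀ i, Ω i) → ℝ≥0∞}

/-- The conditional density `f(x_a, x_b | x_B)` of a pair of variables. -/
noncomputable def condDensityPair (μ : ∀ i, Measure (Ω i)) (f : (∀ i, Ω i) → ℝ≥0∞) (a b : V)
    (B : Finset V) (x : ∀ i, Ω i) : ℝ≥0∞ :=
  marginalDensity μ f (insert a (insert b B)) x / marginalDensity μ f B x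

theorem condDensityPair_comm (f : (∀ i, Ω i) → ℝ≥0∞) (a b : V) (B : Finset V) :
    condDensityPair μ f a b B = condDensityPair μ f b a B := by
  unfold condDensityPair
  rw [Finset.insert_comm]

variable [∀ i, SigmaFinite (μ i)]

theorem IsPositiveDensity.marginalDensity_ae_pos_lt_top (hμ : ∀ i, μ i ≠ 0)
    (hf : IsPositiveDensity μ f) (A : Finset V) :
    ∀ᵐ x ∂Measure.pi μ, marginalDensity μ f A x ≠ 0 ∧ marginalDensity μ f A x ≠ ∞ := by
  filter_upwards [lmarginal_ae_lt_top hf.1 (by simp [hf.2.2]) Aᶜ] with x hx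
  exact ⟨(lmarginal_pos hμ hf.1 (fun x => (hf.2.1 x).1) _ x).ne', hx.ne⟩

theorem IsPositiveDensity.condDensity_mul (hμ : ∀ i, μ i ≠ 0) (hf : IsPositiveDensity μ f)
    (a b : V) (B : Finset V) :
    ∀ᵐ x ∂Measure.pi μ, condDensity μ f a B x * condDensity μ f b (insert a B) x =
      condDensityPair μ f a b B x := by
  filter_upwards [hf.marginalDensity_ae_pos_lt_top hμ (insert a B)] with x ⟨hx0, hxtop⟩
  simp only [condDensity, condDensityPair]
  rw [Finset.insert_comm a b, mul_comm, ← mul_div_assoc, ENNReal.div_mul_cancel hx0 hxtop]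

theorem lmarginal_condDensityPair (hf : Measurable f) {a b : V} (hab : a ≠ b) {B : Finset V}
    (ha : a ∉ B) : ∫⋯∫⁻_{a}, condDensityPair μ f a b B ∂μ = condDensity μ f b B := by
  have hcompl : (insert b B)ᶜ = {a} ∪ (insert a (insert b B))ᶜ := by
    ext i
    rcases eq_or_ne i a with rfl | hi
    · simp [hab, ha]
    · simp [hi]
  have hsplit : marginalDensity μ f (insert b B) =
      ∫⋯∫⁻_{a}, marginalDensity μ f (insert a (insert b B)) ∂μ := by
    rw [marginalDensity, hcompl, lmarginal_union μ f hf (by simp), marginalDensity]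
  have hconst (x : ∀ i, Ω i) (y : Ω a) :
      marginalDensity μ f B (Function.update x a y) = marginalDensity μ f B x :=
    lmarginal_update_of_mem μ (by simpa using ha) f x y
  funext x
  simp only [condDensity, hsplit, lmarginal_singleton, condDensityPair, hconst, div_eq_mul_inv]
  exact lintegral_mul_const _ ((hf.lmarginal μ).comp (measurable_update x))

theorem condDensity_congr_of_covered (hμ : ∀ i, μ i ≠ 0) (hf : IsPositiveDensity μ f)
    (hg : IsPositiveDensity μ g) {a b : V} (hab : a ≠ b) {B : Finset V} (ha : a ∉ B)
    (h₁ : condDensity μ f a B =ᵐ[Measure.pi μ] condDensity μ g a B)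
    (h₂ : condDensity μ f b (insert a B) =ᵐ[Measure.pi μ] condDensity μ g b (insert a B)) :
    condDensity μ f b B =ᵐ[Measure.pi μ] condDensity μ g b B ∧
      condDensity μ f a (insert b B) =ᵐ[Measure.pi μ] condDensity μ g a (insert b B) := by
  have hpair : condDensityPair μ f a b B =ᵐ[Measure.pi μ] condDensityPair μ g a b B := by
    filter_upwards [h₁, h₂, hf.condDensity_mul hμ a b B, hg.condDensity_mul hμ a b B]
      with x e₁ e₂ ef eg
    rw [← ef, ← eg, e₁, e₂]
  have hb : condDensity μ f b B =ᵐ[Measure.pi μ] condDensity μ g b B := by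
    simpa only [lmarginal_condDensityPair hf.1 hab ha, lmarginal_condDensityPair hg.1 hab ha]
      using lmarginal_ae_congr hpair {a}
  refine ⟨hb, ?_⟩
  filter_upwards [hpair, hb, hf.condDensity_mul hμ b a B, hg.condDensity_mul hμ b a B,
    hf.marginalDensity_ae_pos_lt_top hμ B, hf.marginalDensity_ae_pos_lt_top hμ (insert b B)]
    with x epair eb ef eg hB hbB
  rw [condDensityPair_comm f, condDensityPair_comm g, ← ef, ← eg, ← eb] at epair
  exact (ENNReal.mul_right_inj (ENNReal.div_ne_zero.2 ⟨hbB.1, hB.2⟩)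
    (ENNReal.div_ne_top hbB.2 hB.1)).1 epair

end CondDensity

section CoveredEdges

variable {V : Type*} [Fintype V] [DecidableEq V] {Ω : V → Type*} [∀ i, MeasurableSpace (Ω i)]
  {μ : ∀ i, Measure (Ω i)} [∀ i, SigmaFinite (μ i)] {D : Digraph V} {x y : V}

theorem IsCovered.prod_condDensity_turnEdge (hμ : ∀ i, μ i ≠ 0) (hD : IsDAG D)
    (h : IsCovered D x y) {f : (∀ i, Ω i) → ℝ≥0∞} (hf : IsPositiveDensity μ f) :
    (fun z => ∏ i, condDensity μ f i (pa D i) z) =ᵐ[Measure.pi μ]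
      fun z => ∏ i, condDensity μ f i (pa (IntervGraph.turnEdge D x y) i) z := by
  have hpa := (h.turnEdge hD).pa_eq_insert (h.isDAG_turnEdge hD)
  rw [h.pa_turnEdge hD] at hpa
  have hsplit (F : V → ℝ≥0∞) : ∏ i, F i = F x * F y * ∏ i ∈ {x, y}ᶜ, F i := by
    rw [← Finset.prod_mul_prod_compl {x, y}, Finset.prod_pair (hD.ne h.adj)]
  filter_upwards [hf.condDensity_mul hμ x y (pa D x), hf.condDensity_mul hμ y x (pa D x)]
    with z hxy hyx
  rw [hsplit, hsplit, hpa, h.pa_turnEdge hD, h.pa_eq_insert hD, hxy, condDensityPair_comm, ← hyx]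
  congr 1
  · exact mul_comm _ _
  · refine Finset.prod_congr rfl fun i hi => ?_
    simp only [Finset.mem_compl, Finset.mem_insert, Finset.mem_singleton, not_or] at hi
    rw [pa_turnEdge_of_ne hi.1 hi.2]

theorem IsCovered.markovDensities_subset (hμ : ∀ i, μ i ≠ 0) (hD : IsDAG D)
    (h : IsCovered D x y) :
    markovDensities μ D ⊆ markovDensities μ (IntervGraph.turnEdge D x y) :=
  fun _ hf => ⟨hf.1, hf.2.trans (h.prod_condDensity_turnEdge hμ hD hf.1)⟩

variable {ι : Type*} {𝓘 : ι → Finset V}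

theorem IsCovered.interventionalDensities_subset (hμ : ∀ i, μ i ≠ 0) (hD : IsDAG D)
    (h : IsCovered D x y) (hI : ∀ j, x ∈ 𝓘 j ↔ y ∈ 𝓘 j) :
    interventionalDensities μ 𝓘 D ⊆ interventionalDensities μ 𝓘 (IntervGraph.turnEdge D x y) := by
  rintro f ⟨hmarkov, hinv⟩
  refine ⟨fun j => ?_, fun j k c hj hk => ?_⟩
  · by_cases hx : x ∈ 𝓘 j
    · rw [interventionGraph_turnEdge_of_mem hx ((hI j).1 hx)]
      exact hmarkov j
    · rw [interventionGraph_turnEdge_of_notMem hx]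
      exact (h.interventionGraph hx fun hy => hx ((hI j).2 hy)).markovDensities_subset hμ
        (hD.of_le (interventionGraph_le D _)) (hmarkov j)
  · have hcovered (hj : x ∉ 𝓘 j) (hk : x ∉ 𝓘 k) :=
      condDensity_congr_of_covered hμ (hmarkov j).1 (hmarkov k).1 (hD.ne h.adj) (notMem_pa D x)
        (hinv j k x hj hk)
        (h.pa_eq_insert hD ▸ hinv j k y (fun hy => hj ((hI j).2 hy)) fun hy => hk ((hI k).2 hy))
    rcases eq_or_ne c x with rfl | hcx
    · rw [(h.turnEdge hD).pa_eq_insert (h.isDAG_turnEdge hD), h.pa_turnEdge hD]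
      exact (hcovered hj hk).2
    rcases eq_or_ne c y with rfl | hcy
    · rw [h.pa_turnEdge hD]
      exact (hcovered (fun hx => hj ((hI j).1 hx)) fun hx => hk ((hI k).1 hx)).1
    · rw [pa_turnEdge_of_ne hcx hcy]
      exact hinv j k c hj hk

theorem IsCovered.markovEquivalent_turnEdge (hμ : ∀ i, μ i ≠ 0) (hD : IsDAG D)
    (h : IsCovered D x y) (hI : ∀ j, x ∈ 𝓘 j ↔ y ∈ 𝓘 j) :
    MarkovEquivalent μ 𝓘 D (IntervGraph.turnEdge D x y) := by
  refine (h.interventionalDensities_subset hμ hD hI).antisymm ?_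
  simpa only [turnEdge_turnEdge ⟨h.adj, hD.not_adj h.adj⟩] using
    (h.turnEdge hD).interventionalDensities_subset hμ (h.isDAG_turnEdge hD) fun j => (hI j).symm

end CoveredEdges

theorem GraphEquivalent.markovEquivalent {V : Type*} [Fintype V] [DecidableEq V] {Ω : V → Type*}
    [∀ i, MeasurableSpace (Ω i)] {μ : ∀ i, Measure (Ω i)} [∀ i, SigmaFinite (μ i)]
    (hμ : ∀ i, μ i ≠ 0) {ι : Type*} {𝓘 : ι → Finset V} {D₁ D₂ : Digraph V} (hD₁ : IsDAG D₁)
    (hD₂ : IsDAG D₂) (h : GraphEquivalent 𝓘 D₁ D₂) : MarkovEquivalent μ 𝓘 D₁ D₂ :=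
  h.induction_turnEdge (P := fun D => MarkovEquivalent μ 𝓘 D D₂) hD₁ hD₂ (Eq.refl _)
    fun _ _ _ hD hxy hI ih => (hxy.markovEquivalent_turnEdge hμ hD hI).trans ih

/-! ### Parity densities -/

section Perturbation

variable {α : Type*} [MeasurableSpace α]

theorem exists_measurable_ne_zero_lintegral_eq_one (μ : Measure α) [SigmaFinite μ] (hμ : μ ≠ 0) :
    ∃ g : α → ℝ≥0∞, Measurable g ∧ (∀ x, g x ≠ 0) ∧ (∀ x, g x ≠ ∞) ∧ ∫⁻ x, g x ∂μ = 1 := by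
  obtain ⟨g, hg, hgm, hglt⟩ := exists_pos_lintegral_lt_of_sigmaFinite μ one_ne_zero
  have hgm' : Measurable fun x => (g x : ℝ≥0∞) := hgm.coe_nnreal_ennreal
  have hg0 (x : α) : (g x : ℝ≥0∞) ≠ 0 := by simpa using (hg x).ne'
  have htop : ∫⁻ x, g x ∂μ ≠ ∞ := (hglt.trans ENNReal.one_lt_top).ne
  have hzero : ∫⁻ x, g x ∂μ ≠ 0 := by
    rw [← pos_iff_ne_zero, lintegral_pos_iff_support hgm',
      Set.eq_univ_of_forall (s := Function.support fun x => (g x : ℝ≥0∞)) hg0, pos_iff_ne_zero]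
    exact Measure.measure_univ_ne_zero.2 hμ
  refine ⟨fun x => g x * (∫⁻ x, g x ∂μ)⁻¹, hgm'.mul_const _,
    fun x => mul_ne_zero (hg0 x) (ENNReal.inv_ne_zero.2 htop),
    fun x => ENNReal.mul_ne_top ENNReal.coe_ne_top (ENNReal.inv_ne_top.2 hzero), ?_⟩
  rw [lintegral_mul_const _ hgm', ENNReal.mul_inv_cancel hzero htop]

variable {ν : Measure α} [IsProbabilityMeasure ν]

theorem exists_abs_le_one_integral_eq_zero {A B : Set α} (hA : MeasurableSet A)
    (hB : MeasurableSet B) (hAB : Disjoint A B) (hB0 : ν B ≠ 0) :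
    ∃ s : α → ℝ, Measurable s ∧ (∀ x, |s x| ≤ 1) ∧ ∫ x, s x ∂ν = 0 ∧ ∀ x ∈ A, s x ≠ 0 := by
  refine ⟨fun x => A.indicator (fun _ => ν.real B) x - B.indicator (fun _ => ν.real A) x,
    (measurable_const.indicator hA).sub (measurable_const.indicator hB), fun x => ?_, ?_,
    fun x hx => ?_⟩
  · have hindicator (C E : Set α) : C.indicator (fun _ => ν.real E) x ∈ Set.Icc (0 : ℝ) 1 := by
      by_cases hx : x ∈ C <;> simp [hx, measureReal_nonneg, measureReal_le_one]
    simpa using Set.abs_sub_le_of_uIcc_subset_uIcc (Set.uIcc_subset_uIcc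
      (Set.Icc_subset_uIcc (hindicator B A)) (Set.Icc_subset_uIcc (hindicator A B)))
  · rw [integral_sub ((integrable_const _).indicator hA) ((integrable_const _).indicator hB),
      integral_indicator_const _ hA, integral_indicator_const _ hB]
    simp [mul_comm]
  · have hxB : x ∉ B := Set.disjoint_left.1 hAB hx
    simpa [hx, hxB, measureReal_eq_zero_iff] using hB0

theorem lintegral_ofReal_one_add_mul {s : α → ℝ} (hs : Measurable s) (hle : ∀ x, |s x| ≤ 1)
    (hint : ∫ x, s x ∂ν = 0) {r : ℝ} (hr : |r| ≤ 1) :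
    ∫⁻ x, ENNReal.ofReal (1 + r * s x) ∂ν = 1 := by
  have hs_int : Integrable s ν := .of_bound hs.aestronglyMeasurable 1 (ae_of_all _ hle)
  have hnonneg (x : α) : 0 ≤ 1 + r * s x := by
    have : |r * s x| ≤ 1 := abs_mul r (s x) ▸ mul_le_one₀ hr (abs_nonneg _) (hle x)
    linarith [(abs_le.1 this).1]
  have hint' : ∫ x, (1 + r * s x) ∂ν = 1 := by
    rw [integral_add (integrable_const _) (hs_int.const_mul r), integral_const_mul, hint]
    simp
  rw [← ofReal_integral_eq_lintegral_ofReal ?_ (ae_of_all _ hnonneg), hint', ENNReal.ofReal_one]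
  exact (integrable_const _).add (hs_int.const_mul r)

/-- `g` is a positive probability density and `s` a function with values in `[-1, 1]` that has mean
`0` under `g` and is not almost everywhere zero. The mean condition is encoded by saying that
`g * (1 + r * s)` is a probability density for all `r ∈ [-1, 1]`. -/
structure IsPerturbation (μ : Measure α) (g : α → ℝ≥0∞) (s : α → ℝ) : Prop where
  measurable_density : Measurable g
  measurable_sign : Measurable s
  ne_zero : ∀ x, g x ≠ 0
  ne_top : ∀ x, g x ≠ ∞
  abs_le : ∀ x, |s x| ≤ 1
  lintegral_mul : ∀ r : ℝ, |r| ≤ 1 → ∫⁻ x, g x * ENNReal.ofReal (1 + r * s x) ∂μ = 1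
  measure_support : μ {x | s x ≠ 0} ≠ 0

/-- There are two disjoint measurable sets of positive measure. This is what is needed for a random
variable with a density with respect to `μ` not to be almost surely constant. -/
def HasDisjointPositiveSets (μ : Measure α) : Prop :=
  ∃ A B : Set α, MeasurableSet A ∧ MeasurableSet B ∧ Disjoint A B ∧ 0 < μ A ∧ 0 < μ B

theorem HasDisjointPositiveSets.ne_zero {μ : Measure α} (h : HasDisjointPositiveSets μ) :
    μ ≠ 0 := by
  rintro rfl
  obtain ⟨A, -, -, -, -, hA, -⟩ := h
  simp at hA

theorem HasDisjointPositiveSets.exists_isPerturbation {μ : Measure α} [SigmaFinite μ]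
    (h : HasDisjointPositiveSets μ) : ∃ g s, IsPerturbation μ g s := by
  obtain ⟨g, hg, hg0, hgtop, hg1⟩ := exists_measurable_ne_zero_lintegral_eq_one μ h.ne_zero
  obtain ⟨A, B, hA, hB, hAB, hA0, hB0⟩ := h
  have : IsProbabilityMeasure (μ.withDensity g) :=
    ⟨by rw [withDensity_apply _ .univ, setLIntegral_univ, hg1]⟩
  have hac : μ ≪ μ.withDensity g :=
    withDensity_absolutelyContinuous' hg.aemeasurable (ae_of_all _ hg0)
  obtain ⟨s, hs, hle, hint, hsA⟩ :=
    exists_abs_le_one_integral_eq_zero hA hB hAB fun h => hB0.ne' (hac h)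
  refine ⟨g, s, hg, hs, hg0, hgtop, hle, fun r hr => ?_, (hA0.trans_le (measure_mono hsA)).ne'⟩
  rw [← lintegral_ofReal_one_add_mul hs hle hint hr]
  exact (lintegral_withDensity_eq_lintegral_mul μ hg (by fun_prop)).symm

theorem IsPerturbation.lintegral_eq_one {μ : Measure α} {g : α → ℝ≥0∞} {s : α → ℝ}
    (h : IsPerturbation μ g s) : ∫⁻ x, g x ∂μ = 1 := by
  simpa using h.lintegral_mul 0

end Perturbation

section ParityDensity

variable {V : Type*} {Ω : V → Type*}

/-- The factor by which `parityMarginal` may differ from a product density. -/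
noncomputable def parityWeight (s : ∀ i, Ω i → ℝ) (S : Finset V) (t : ℝ) (x : ∀ i, Ω i) : ℝ≥0∞ :=
  ENNReal.ofReal (1 + t * ∏ i ∈ S, s i (x i))

/-- The marginal density on the variables in `A` of the density `parityDensity`. -/
noncomputable def parityMarginal [DecidableEq V] (g : ∀ i, Ω i → ℝ≥0∞) (s : ∀ i, Ω i → ℝ)
    (S : Finset V) (t : ℝ) (A : Finset V) (x : ∀ i, Ω i) : ℝ≥0∞ :=
  (∏ i ∈ A, g i (x i)) * if S ⊆ A then parityWeight s S t x else 1

/-- A density under which, for `t ≠ 0`, the variables in `S` are dependent, although those in any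
proper subset of `S` are independent. -/
noncomputable def parityDensity [Fintype V] [DecidableEq V] (g : ∀ i, Ω i → ℝ≥0∞)
    (s : ∀ i, Ω i → ℝ) (S : Finset V) (t : ℝ) : (∀ i, Ω i) → ℝ≥0∞ :=
  parityMarginal g s S t Finset.univ

theorem parityDensity_apply [Fintype V] [DecidableEq V] (g : ∀ i, Ω i → ℝ≥0∞)
    (s : ∀ i, Ω i → ℝ) (S : Finset V) (t : ℝ) (x : ∀ i, Ω i) :
    parityDensity g s S t x = (∏ i, g i (x i)) * parityWeight s S t x := by
  rw [parityDensity, parityMarginal, if_pos (Finset.subset_univ S)]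

section Update

variable [DecidableEq V] {A : Finset V} {a : V}

theorem prod_apply_update_of_mem {M : Type*} [CommMonoid M] (f : ∀ i, Ω i → M) (ha : a ∈ A)
    (x : ∀ i, Ω i) (y : Ω a) :
    ∏ i ∈ A, f i (Function.update x a y i) = f a y * ∏ i ∈ A.erase a, f i (x i) := by
  simp only [Function.apply_update f, Finset.prod_update_of_mem ha, Finset.sdiff_singleton_eq_erase]

theorem prod_apply_update_of_notMem {M : Type*} [CommMonoid M] (f : ∀ i, Ω i → M) (ha : a ∉ A)
    (x : ∀ i, Ω i) (y : Ω a) :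
    ∏ i ∈ A, f i (Function.update x a y i) = ∏ i ∈ A, f i (x i) := by
  simp only [Function.apply_update f, Finset.prod_update_of_notMem ha]

end Update

variable [∀ i, MeasurableSpace (Ω i)] {μ : ∀ i, Measure (Ω i)} {g : ∀ i, Ω i → ℝ≥0∞}
  {s : ∀ i, Ω i → ℝ} {t : ℝ}

theorem abs_mul_prod_le (hs : ∀ i, IsPerturbation (μ i) (g i) (s i)) (t : ℝ) (S : Finset V)
    (x : ∀ i, Ω i) : |t * ∏ i ∈ S, s i (x i)| ≤ |t| := by
  rw [abs_mul, Finset.abs_prod]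
  exact mul_le_of_le_one_right (abs_nonneg t)
    (Finset.prod_le_one (fun _ _ => abs_nonneg _) fun i _ => (hs i).abs_le _)

theorem parityWeight_ne_zero (hs : ∀ i, IsPerturbation (μ i) (g i) (s i)) (ht : |t| < 1)
    (S : Finset V) (x : ∀ i, Ω i) : parityWeight s S t x ≠ 0 := by
  rw [parityWeight, Ne, ENNReal.ofReal_eq_zero, not_le]
  linarith [(abs_le.1 (abs_mul_prod_le hs t S x)).1]

theorem prod_density_ne_zero (hs : ∀ i, IsPerturbation (μ i) (g i) (s i)) (A : Finset V)
    (x : ∀ i, Ω i) : ∏ i ∈ A, g i (x i) ≠ 0 :=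
  Finset.prod_ne_zero_iff.2 fun i _ => (hs i).ne_zero _

theorem prod_density_ne_top (hs : ∀ i, IsPerturbation (μ i) (g i) (s i)) (A : Finset V)
    (x : ∀ i, Ω i) : ∏ i ∈ A, g i (x i) ≠ ∞ :=
  ENNReal.prod_ne_top fun i _ => (hs i).ne_top _

theorem not_parityWeight_ae_eq_one [Fintype V] [∀ i, SigmaFinite (μ i)]
    (hs : ∀ i, IsPerturbation (μ i) (g i) (s i)) (ht : t ≠ 0) (S : Finset V) :
    ¬ ∀ᵐ x ∂Measure.pi μ, parityWeight s S t x = 1 := by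
  intro h
  have hsub : Set.univ.pi (fun i => {y | s i y ≠ 0}) ⊆ {x | ¬ parityWeight s S t x = 1} := by
    intro x hx heq
    have hprod : ∏ i ∈ S, s i (x i) ≠ 0 := Finset.prod_ne_zero_iff.2 fun i _ => hx i trivial
    rw [parityWeight, ENNReal.ofReal_eq_one, add_eq_left] at heq
    exact mul_ne_zero ht hprod heq
  have hnull := measure_mono_null hsub (ae_iff.1 h)
  rw [Measure.pi_pi, Finset.prod_eq_zero_iff] at hnull
  obtain ⟨i, -, hi⟩ := hnull
  exact (hs i).measure_support hi

variable [DecidableEq V]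

theorem measurable_parityMarginal (hs : ∀ i, IsPerturbation (μ i) (g i) (s i)) (S : Finset V)
    (t : ℝ) (A : Finset V) : Measurable (parityMarginal g s S t A) := by
  have hg (i : V) : Measurable fun x : ∀ i, Ω i => g i (x i) :=
    (hs i).measurable_density.comp (measurable_pi_apply i)
  have hsign (i : V) : Measurable fun x : ∀ i, Ω i => s i (x i) :=
    (hs i).measurable_sign.comp (measurable_pi_apply i)
  have hweight : Measurable (parityWeight s S t) :=
    (((Finset.measurable_fun_prod _ fun i _ => hsign i).const_mul t).const_add 1).ennreal_ofReal
  refine (Finset.measurable_fun_prod _ fun i _ => hg i).mul ?_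
  split_ifs
  exacts [hweight, measurable_const]

theorem lintegral_parityMarginal_update
    (hs : ∀ i, IsPerturbation (μ i) (g i) (s i)) (ht : |t| ≤ 1) (S : Finset V) {A : Finset V}
    {a : V} (ha : a ∈ A) (x : ∀ i, Ω i) :
    ∫⁻ y, parityMarginal g s S t A (Function.update x a y) ∂μ a =
      parityMarginal g s S t (A.erase a) x := by
  simp only [parityMarginal, prod_apply_update_of_mem g ha]
  by_cases haS : a ∈ S ∧ S ⊆ A
  · have hweight (y : Ω a) : parityWeight s S t (Function.update x a y) =
        ENNReal.ofReal (1 + (t * ∏ i ∈ S.erase a, s i (x i)) * s a y) := by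
      rw [parityWeight, prod_apply_update_of_mem s haS.1, mul_assoc, mul_comm (s a y)]
    have hsub : ¬ S ⊆ A.erase a := fun h => Finset.notMem_erase a A (h haS.1)
    have hmeas : Measurable fun y => g a y *
        ENNReal.ofReal (1 + (t * ∏ i ∈ S.erase a, s i (x i)) * s a y) :=
      (hs a).measurable_density.mul
        (((hs a).measurable_sign.const_mul _).const_add 1).ennreal_ofReal
    simp only [if_pos haS.2, if_neg hsub, hweight,
      fun y => mul_right_comm (g a y) (∏ i ∈ A.erase a, g i (x i))]
    rw [lintegral_mul_const _ hmeas,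
      (hs a).lintegral_mul _ ((abs_mul_prod_le hs t _ x).trans ht), mul_comm]
  · have hweight (y : Ω a) : (if S ⊆ A then parityWeight s S t (Function.update x a y) else 1) =
        if S ⊆ A.erase a then parityWeight s S t x else 1 := by
      simp only [Finset.subset_erase]
      by_cases hS : S ⊆ A
      · have haS' : a ∉ S := fun h => haS ⟨h, hS⟩
        simp only [hS, haS', not_false_eq_true, and_self, if_true, parityWeight,
          prod_apply_update_of_notMem s haS']
      · simp only [hS, false_and, if_false]
    simp only [hweight, mul_assoc]
    rw [lintegral_mul_const _ (hs a).measurable_density, (hs a).lintegral_eq_one, one_mul]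

variable [Fintype V] [∀ i, SigmaFinite (μ i)]

theorem marginalDensity_parityDensity (hs : ∀ i, IsPerturbation (μ i) (g i) (s i)) (ht : |t| ≤ 1)
    (S A : Finset V) :
    marginalDensity μ (parityDensity g s S t) A = parityMarginal g s S t A := by
  suffices h : ∀ B : Finset V,
      ∫⋯∫⁻_B, parityDensity g s S t ∂μ = parityMarginal g s S t Bᶜ by
    rw [marginalDensity, h, compl_compl]
  intro B
  induction B using Finset.induction_on with
  | empty => rw [lmarginal_empty, Finset.compl_empty, parityDensity]
  | insert a B ha ih =>
    funext x
    have hmeas : Measurable (parityDensity g s S t) := measurable_parityMarginal hs S t _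
    rw [lmarginal_insert _ hmeas ha, ih, Finset.compl_insert]
    exact lintegral_parityMarginal_update hs ht S (Finset.mem_compl.2 ha) x

theorem isPositiveDensity_parityDensity (hs : ∀ i, IsPerturbation (μ i) (g i) (s i)) (ht : |t| < 1)
    {S : Finset V} (hS : S.Nonempty) : IsPositiveDensity μ (parityDensity g s S t) := by
  refine ⟨measurable_parityMarginal hs S t _,
    fun x => ⟨pos_iff_ne_zero.2 ?_, lt_top_iff_ne_top.2 ?_⟩, ?_⟩
  · rw [parityDensity_apply]
    exact mul_ne_zero (prod_density_ne_zero hs _ x) (parityWeight_ne_zero hs ht S x)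
  · rw [parityDensity_apply]
    exact ENNReal.mul_ne_top (prod_density_ne_top hs _ x) ENNReal.ofReal_ne_top
  · have hne (i : V) : Nonempty (Ω i) :=
      (nonempty_of_measure_ne_zero (hs i).measure_support).to_type
    have x : ∀ i, Ω i := fun i => (hne i).some
    rw [lintegral_eq_lmarginal_univ x, ← Finset.compl_empty, ← marginalDensity,
      marginalDensity_parityDensity hs ht.le, parityMarginal, Finset.prod_empty, one_mul,
      if_neg (by simpa using hS.ne_empty)]

theorem condDensity_parityDensity (hs : ∀ i, IsPerturbation (μ i) (g i) (s i)) (ht : |t| < 1)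
    {S B : Finset V} {a : V} (ha : a ∉ B) (x : ∀ i, Ω i) :
    condDensity μ (parityDensity g s S t) a B x =
      g a (x a) * if a ∈ S ∧ S ⊆ insert a B then parityWeight s S t x else 1 := by
  rw [condDensity, marginalDensity_parityDensity hs ht.le, marginalDensity_parityDensity hs ht.le,
    parityMarginal, parityMarginal, Finset.prod_insert ha, mul_comm (g a _), mul_assoc,
    ENNReal.mul_div_mul_left _ _ (prod_density_ne_zero hs B x) (prod_density_ne_top hs B x),
    mul_div_assoc]
  congr 1
  by_cases hB : S ⊆ B
  · have haS : a ∉ S := fun h => ha (hB h)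
    rw [if_pos (hB.trans (Finset.subset_insert _ _)), if_pos hB, if_neg fun h => haS h.1]
    exact ENNReal.div_self (parityWeight_ne_zero hs ht S x) ENNReal.ofReal_ne_top
  · have hiff : S ⊆ insert a B ↔ a ∈ S ∧ S ⊆ insert a B := by
      refine iff_and_self.2 fun h => ?_
      by_contra haS
      exact hB ((Finset.subset_insert_iff_of_notMem haS).1 h)
    rw [if_neg hB, div_one]
    exact if_congr hiff rfl rfl

end ParityDensity

/-! ### Markov equivalence is graphical -/

section CommonChild

variable {V : Type*} {D : Digraph V} {S : Finset V} {a b : V}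

/-- `b` belongs to `S` and is a child of all other elements of `S`. -/
structure IsCommonChild (D : Digraph V) (S : Finset V) (b : V) : Prop where
  mem : b ∈ S
  adj : ∀ a ∈ S, a ≠ b → D.Adj a b

theorem IsCommonChild.eq (hD : IsDAG D) (ha : IsCommonChild D S a) (hb : IsCommonChild D S b) :
    a = b := by
  by_contra hab
  exact hD.not_adj (hb.adj a ha.mem hab) (ha.adj b hb.mem (Ne.symm hab))

variable [DecidableEq V]

theorem isCommonChild_insert (h : ∀ a ∈ S, D.Adj a b) : IsCommonChild D (insert b S) b where
  mem := Finset.mem_insert_self b S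
  adj a ha hab := h a (Finset.mem_of_mem_insert_of_ne ha hab)

theorem isCommonChild_iff_subset_insert_pa [Fintype V] (hD : IsDAG D) :
    IsCommonChild D S b ↔ b ∈ S ∧ S ⊆ insert b (pa D b) := by
  refine ⟨fun h => ⟨h.mem, fun a ha => Finset.mem_insert.2 (or_iff_not_imp_left.2 fun hab => ?_)⟩,
    fun h => ⟨h.1, fun a ha hab => ?_⟩⟩
  · exact hD.mem_pa_iff.2 (h.adj a ha hab)
  · exact hD.mem_pa_iff.1 (Finset.mem_of_mem_insert_of_ne (h.2 ha) hab)

end CommonChild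

section Separation

variable {V : Type*} [Fintype V] [DecidableEq V] {Ω : V → Type*} [∀ i, MeasurableSpace (Ω i)]
  {μ : ∀ i, Measure (Ω i)} [∀ i, SigmaFinite (μ i)] {D : Digraph V} {S : Finset V} {b : V}

section ParityDensity

variable {g : ∀ i, Ω i → ℝ≥0∞} {s : ∀ i, Ω i → ℝ} {t : ℝ}

open Classical in
theorem condDensity_parityDensity_pa (hs : ∀ i, IsPerturbation (μ i) (g i) (s i)) (ht : |t| < 1)
    (hD : IsDAG D) (S : Finset V) (a : V) (x : ∀ i, Ω i) :
    condDensity μ (parityDensity g s S t) a (pa D a) x =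
      g a (x a) * if IsCommonChild D S a then parityWeight s S t x else 1 := by
  rw [condDensity_parityDensity hs ht (notMem_pa D a)]
  exact congrArg _ (if_congr (isCommonChild_iff_subset_insert_pa hD).symm rfl rfl)

theorem parityDensity_mem_markovDensities (hs : ∀ i, IsPerturbation (μ i) (g i) (s i))
    (ht : |t| < 1) (hD : IsDAG D) (hb : b ∈ S) (h : t = 0 ∨ IsCommonChild D S b) :
    parityDensity g s S t ∈ markovDensities μ D := by
  classical
  refine ⟨isPositiveDensity_parityDensity hs ht ⟨b, hb⟩, ae_of_all _ fun x => ?_⟩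
  simp only [condDensity_parityDensity_pa hs ht hD, Finset.prod_mul_distrib, parityDensity_apply]
  congr 1
  rcases h with rfl | h
  · simp [parityWeight]
  · rw [Finset.prod_eq_single b, if_pos h]
    · exact fun i _ hib => if_neg fun hi => hib (hi.eq hD h)
    · exact fun hb => absurd (Finset.mem_univ b) hb

theorem exists_isCommonChild_of_parityDensity_mem_markovDensities
    (hs : ∀ i, IsPerturbation (μ i) (g i) (s i)) (ht : |t| < 1) (ht0 : t ≠ 0) (hD : IsDAG D)
    (h : parityDensity g s S t ∈ markovDensities μ D) : ∃ b, IsCommonChild D S b := by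
  classical
  by_contra! hno
  refine not_parityWeight_ae_eq_one hs ht0 S ?_
  filter_upwards [h.2] with x hx
  simp only [condDensity_parityDensity_pa hs ht hD, hno, if_false, mul_one,
    parityDensity_apply] at hx
  exact (ENNReal.mul_eq_left (prod_density_ne_zero hs _ x) (prod_density_ne_top hs _ x)).1 hx

theorem parityDensity_mem_interventionalDensities (hs : ∀ i, IsPerturbation (μ i) (g i) (s i))
    (ht : |t| < 1) (hD : IsDAG D) (h : IsCommonChild D S b) {ι : Type*} (𝓘 : ι → Finset V) :
    (fun k => parityDensity g s S (if b ∈ 𝓘 k then 0 else t)) ∈ interventionalDensities μ 𝓘 D := by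
  classical
  have ht' (k : ι) : |if b ∈ 𝓘 k then 0 else t| < 1 := by
    split_ifs
    exacts [by simp, ht]
  refine ⟨fun k => parityDensity_mem_markovDensities hs (ht' k)
    (hD.of_le (interventionGraph_le D _)) h.mem ?_, fun k l a hk hl => ae_of_all _ fun x => ?_⟩
  · split_ifs with hbk
    · exact .inl rfl
    · exact .inr ⟨h.mem, fun a ha hab => ⟨h.adj a ha hab, hbk⟩⟩
  · rw [condDensity_parityDensity_pa hs (ht' k) hD, condDensity_parityDensity_pa hs (ht' l) hD]
    by_cases ha : IsCommonChild D S a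
    · obtain rfl := ha.eq hD h
      rw [if_neg hk, if_neg hl]
    · rw [if_neg ha, if_neg ha]

end ParityDensity

variable {ι : Type*} {𝓘 : ι → Finset V} {D₁ D₂ : Digraph V}

theorem exists_isCommonChild_of_interventionalDensities_subset
    (hμ : ∀ i, HasDisjointPositiveSets (μ i)) (hD₁ : IsDAG D₁) (hD₂ : IsDAG D₂)
    (h : interventionalDensities μ 𝓘 D₁ ⊆ interventionalDensities μ 𝓘 D₂)
    (hb : IsCommonChild D₁ S b) {j : ι} (hj : b ∉ 𝓘 j) :
    ∃ i, IsCommonChild (interventionGraph D₂ (𝓘 j)) S i := by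
  choose g s hs using fun i => (hμ i).exists_isPerturbation
  have ht : |(1 / 2 : ℝ)| < 1 := by norm_num [abs_of_pos]
  have hmem := (h (parityDensity_mem_interventionalDensities hs ht hD₁ hb 𝓘)).1 j
  simp only [if_neg hj] at hmem
  exact exists_isCommonChild_of_parityDensity_mem_markovDensities hs ht (by norm_num)
    (hD₂.of_le (interventionGraph_le D₂ _)) hmem

theorem adj_or_adj_of_interventionalDensities_subset
    (hμ : ∀ i, HasDisjointPositiveSets (μ i)) (hD₁ : IsDAG D₁) (hD₂ : IsDAG D₂)
    (h : interventionalDensities μ 𝓘 D₁ ⊆ interventionalDensities μ 𝓘 D₂) {a b : V}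
    (hab : D₁.Adj a b) {j : ι} (hj : b ∉ 𝓘 j) : D₂.Adj a b ∨ (D₂.Adj b a ∧ a ∉ 𝓘 j) := by
  have hchild : IsCommonChild D₁ {b, a} b := isCommonChild_insert (by simpa using hab)
  obtain ⟨i, hi⟩ := exists_isCommonChild_of_interventionalDensities_subset hμ hD₁ hD₂ h hchild hj
  have hne := hD₁.ne hab
  rcases by simpa using hi.mem with rfl | rfl
  · exact .inl (hi.adj a (by simp) hne).1
  · exact .inr (hi.adj b (by simp) hne.symm)

theorem isAdjacent_of_interventionalDensities_subset
    (hμ : ∀ i, HasDisjointPositiveSets (μ i)) (h𝓘 : IsConservative 𝓘)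
    (hD₁ : IsDAG D₁) (hD₂ : IsDAG D₂)
    (h : interventionalDensities μ 𝓘 D₁ ⊆ interventionalDensities μ 𝓘 D₂) {a b : V}
    (hab : IsAdjacent D₁ a b) : IsAdjacent D₂ a b := by
  wlog hadj : D₁.Adj a b generalizing a b
  · exact (this hab.symm (hab.resolve_left hadj)).symm
  obtain ⟨j, hj⟩ := h𝓘 b
  exact (adj_or_adj_of_interventionalDensities_subset hμ hD₁ hD₂ h hadj hj).imp_right And.left

theorem isVStructure_of_markovEquivalent
    (hμ : ∀ i, HasDisjointPositiveSets (μ i)) (h𝓘 : IsConservative 𝓘)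
    (hD₁ : IsDAG D₁) (hD₂ : IsDAG D₂)
    (h : MarkovEquivalent μ 𝓘 D₁ D₂) {a b c : V} (habc : IsVStructure D₁ a b c) :
    IsVStructure D₂ a b c := by
  obtain ⟨hab, hcb, hac, hn⟩ := habc
  have hn' : ¬ IsAdjacent D₂ a c := fun h' =>
    hn (isAdjacent_of_interventionalDensities_subset hμ h𝓘 hD₂ hD₁ h.superset h')
  obtain ⟨j, hj⟩ := h𝓘 b
  have hchild : IsCommonChild D₁ {b, a, c} b := isCommonChild_insert (by simp [hab, hcb])
  obtain ⟨i, hi⟩ :=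
    exists_isCommonChild_of_interventionalDensities_subset hμ hD₁ hD₂ h.subset hchild hj
  rcases by simpa using hi.mem with rfl | rfl | rfl
  · exact ⟨(hi.adj a (by simp) (hD₁.ne hab)).1, (hi.adj c (by simp) (hD₁.ne hcb)).1, hac, hn'⟩
  · exact absurd (.inr (hi.adj c (by simp) hac.symm).1) hn'
  · exact absurd (.inl (hi.adj a (by simp) hac).1) hn'

theorem graphEquivalent_of_markovEquivalent
    (hμ : ∀ i, HasDisjointPositiveSets (μ i)) (h𝓘 : IsConservative 𝓘)
    (hD₁ : IsDAG D₁) (hD₂ : IsDAG D₂)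
    (h : MarkovEquivalent μ 𝓘 D₁ D₂) : GraphEquivalent 𝓘 D₁ D₂ where
  isAdjacent_iff _ _ :=
    ⟨isAdjacent_of_interventionalDensities_subset hμ h𝓘 hD₁ hD₂ h.subset,
      isAdjacent_of_interventionalDensities_subset hμ h𝓘 hD₂ hD₁ h.superset⟩
  isVStructure_iff _ _ _ :=
    ⟨isVStructure_of_markovEquivalent hμ h𝓘 hD₁ hD₂ h,
      isVStructure_of_markovEquivalent hμ h𝓘 hD₂ hD₁ h.symm⟩
  mem_iff a b hab hba j := by
    rw [← not_iff_not]
    exact ⟨fun hj => ((adj_or_adj_of_interventionalDensities_subset hμ hD₂ hD₁ h.superset hba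
        hj).resolve_left (hD₁.not_adj hab)).2,
      fun hj => ((adj_or_adj_of_interventionalDensities_subset hμ hD₁ hD₂ h.subset hab
        hj).resolve_left (hD₂.not_adj hba)).2⟩

theorem markovEquivalent_iff_graphEquivalent
    (hμ : ∀ i, HasDisjointPositiveSets (μ i)) (h𝓘 : IsConservative 𝓘)
    (hD₁ : IsDAG D₁) (hD₂ : IsDAG D₂) :
    MarkovEquivalent μ 𝓘 D₁ D₂ ↔ GraphEquivalent 𝓘 D₁ D₂ :=
  ⟨graphEquivalent_of_markovEquivalent hμ h𝓘 hD₁ hD₂,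
    fun h => h.markovEquivalent (fun i => (hμ i).ne_zero) hD₁ hD₂⟩

end Separation

/-! ### Essential graphs as unions of graphically equivalent DAGs -/

section Representation

variable {V ι : Type*} {𝓘 : ι → Finset V} {G D E : Digraph V} {a b c : V}

theorem GraphEquivalent.refl (hD : IsDAG D) : GraphEquivalent 𝓘 D D :=
  ⟨fun _ _ => Iff.rfl, fun _ _ _ => Iff.rfl, fun _ _ h h' => absurd h' (hD.not_adj h)⟩

theorem GraphEquivalent.symm (h : GraphEquivalent 𝓘 D E) : GraphEquivalent 𝓘 E D :=
  ⟨fun a b => (h.isAdjacent_iff a b).symm, fun a b c => (h.isVStructure_iff a b c).symm,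
    fun a b hE hD j => (h.mem_iff b a hD hE j).symm⟩

theorem GraphEquivalent.trans {F : Digraph V} (hDE : GraphEquivalent 𝓘 D E)
    (hEF : GraphEquivalent 𝓘 E F) : GraphEquivalent 𝓘 D F where
  isAdjacent_iff a b := (hDE.isAdjacent_iff a b).trans (hEF.isAdjacent_iff a b)
  isVStructure_iff a b c := (hDE.isVStructure_iff a b c).trans (hEF.isVStructure_iff a b c)
  mem_iff a b hD hF := ((hDE.isAdjacent_iff a b).1 (.inl hD)).elim
    (fun hE => hEF.mem_iff a b hE hF) fun hE => hDE.mem_iff a b hD hE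

/-- The DAG `D` represents `G` if `G` is the union of all DAGs graphically equivalent to `D`.
This is the measure-free counterpart of `G` being the essential graph of `D`. -/
structure Represents (𝓘 : ι → Finset V) (G D : Digraph V) : Prop where
  isDAG : IsDAG D
  adj_iff : ∀ a b, G.Adj a b ↔ ∃ E, IsDAG E ∧ GraphEquivalent 𝓘 E D ∧ E.Adj a b

namespace Represents

theorem of_graphEquivalent (h : Represents 𝓘 G D) (hE : IsDAG E) (hED : GraphEquivalent 𝓘 E D) :
    Represents 𝓘 G E where
  isDAG := hE
  adj_iff a b := (h.adj_iff a b).trans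
    ⟨fun ⟨F, hF, hFD, hab⟩ => ⟨F, hF, hFD.trans hED.symm, hab⟩,
      fun ⟨F, hF, hFE, hab⟩ => ⟨F, hF, hFE.trans hED, hab⟩⟩

theorem exists_adj (h : Represents 𝓘 G D) (hab : G.Adj a b) :
    ∃ E, Represents 𝓘 G E ∧ GraphEquivalent 𝓘 E D ∧ E.Adj a b :=
  let ⟨E, hE, hED, hEab⟩ := (h.adj_iff a b).1 hab
  ⟨E, h.of_graphEquivalent hE hED, hED, hEab⟩

theorem le (h : Represents 𝓘 G D) : D ≤ G :=
  fun a b hab => (h.adj_iff a b).2 ⟨D, h.isDAG, .refl h.isDAG, hab⟩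

theorem isAdjacent_iff (h : Represents 𝓘 G D) (a b : V) : IsAdjacent G a b ↔ IsAdjacent D a b := by
  have of_adj : ∀ {a b}, G.Adj a b → IsAdjacent D a b := fun hab =>
    let ⟨_, _, hED, hEab⟩ := h.exists_adj hab
    (hED.isAdjacent_iff _ _).1 (.inl hEab)
  exact ⟨fun hab => hab.elim of_adj fun hba => (of_adj hba).symm, .imp (h.le ·) (h.le ·)⟩

theorem adj_of_isArrow (h : Represents 𝓘 G D) (hab : IsArrow G a b) : D.Adj a b :=
  ((h.isAdjacent_iff a b).1 (.inl hab.1)).resolve_right fun hba => hab.2 (h.le hba)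

theorem mem_iff_of_isLine (h : Represents 𝓘 G D) (hab : IsLine G a b) (j : ι) :
    a ∈ 𝓘 j ↔ b ∈ 𝓘 j :=
  let ⟨_, _, hED, hEab⟩ := h.exists_adj hab.1
  let ⟨_, _, hFD, hFba⟩ := h.exists_adj hab.2
  (hED.trans hFD.symm).mem_iff a b hEab hFba j

theorem isVStructure_iff (h : Represents 𝓘 G D) (a b c : V) :
    IsVStructure D a b c ↔ IsArrow G a b ∧ IsArrow G c b ∧ a ≠ c ∧ ¬ IsAdjacent G a c := by
  rw [h.isAdjacent_iff a c]
  refine ⟨fun hv => ⟨⟨h.le hv.1, fun hba => ?_⟩, ⟨h.le hv.2.1, fun hbc => ?_⟩, hv.2.2⟩,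
    fun ⟨hab, hcb, hv⟩ => ⟨h.adj_of_isArrow hab, h.adj_of_isArrow hcb, hv⟩⟩
  · obtain ⟨E, hE, hED, hEba⟩ := h.exists_adj hba
    exact hE.isDAG.not_adj hEba ((hED.isVStructure_iff a b c).2 hv).1
  · obtain ⟨E, hE, hED, hEbc⟩ := h.exists_adj hbc
    exact hE.isDAG.not_adj hEbc ((hED.isVStructure_iff a b c).2 hv).2.1

theorem of_isVStructure_iff (h : Represents 𝓘 G D) (hE : IsDAG E) (hEG : E ≤ G)
    (hadj : ∀ a b, IsAdjacent G a b ↔ IsAdjacent E a b)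
    (hv : ∀ a b c, IsVStructure E a b c ↔ IsVStructure D a b c) : Represents 𝓘 G E :=
  h.of_graphEquivalent hE
    ⟨fun a b => (hadj a b).symm.trans (h.isAdjacent_iff a b), hv,
      fun _ _ hab hba => h.mem_iff_of_isLine ⟨hEG hab, h.le hba⟩⟩

theorem isAdjacent_of_isArrow_of_isLine (h : Represents 𝓘 G D) (hab : IsArrow G a b)
    (hbc : IsLine G b c) : IsAdjacent G a c := by
  by_contra hac
  have hne : a ≠ c := by
    rintro rfl
    exact hab.2 hbc.1
  obtain ⟨E, hE, -, hcb⟩ := h.exists_adj hbc.2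
  rw [hE.isAdjacent_iff] at hac
  exact ((hE.isVStructure_iff a b c).1 ⟨hE.adj_of_isArrow hab, hcb, hne, hac⟩).2.1.2 hbc.1

theorem adj_of_isArrow_of_isLine (h : Represents 𝓘 G D) (hab : IsArrow G a b)
    (hbc : IsLine G b c) (hbc' : D.Adj b c) : D.Adj a c :=
  ((h.isAdjacent_iff a c).1 (h.isAdjacent_of_isArrow_of_isLine hab hbc)).resolve_right
    (h.isDAG.not_adj_of_adj_of_adj (h.adj_of_isArrow hab) hbc')

end Represents

theorem mem_chainComponent_self (G : Digraph V) (a : V) : a ∈ chainComponent G a := ⟨.refl, .refl⟩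

theorem IsLine.mem_chainComponent (h : IsLine G a b) : b ∈ chainComponent G a :=
  ⟨.single h.1, .single h.2⟩

theorem isAdjacent_of_mem_representatives (hD : D ∈ representatives G) (hac : a ≠ c)
    (ha : a ∈ chainComponent G b) (hc : c ∈ chainComponent G b) (hab : D.Adj a b)
    (hcb : D.Adj c b) : IsAdjacent G a c := by
  obtain ⟨-, hle, -, hpeo⟩ := hD
  obtain ⟨σ, hσ, hσD⟩ := hpeo b
  have hb := mem_chainComponent_self G b
  have := hσ (σ.symm ⟨b, hb⟩) (σ.symm ⟨a, ha⟩) (σ.symm ⟨c, hc⟩) (hσD ⟨a, ha⟩ ⟨b, hb⟩ hab)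
    (hσD ⟨c, hc⟩ ⟨b, hb⟩ hcb) fun h => hac (congrArg Subtype.val (σ.symm.injective h))
  simp only [Equiv.apply_symm_apply] at this
  exact this (.inl (hle hab)) (.inl (hle hcb))

theorem Represents.isArrow_and_isArrow_of_mem_representatives (h : Represents 𝓘 G E)
    (hD : D ∈ representatives G) (hab : D.Adj a b) (hcb : D.Adj c b) (hac : a ≠ c)
    (hn : ¬ IsAdjacent G a c) : IsArrow G a b ∧ IsArrow G c b := by
  have hab' := hD.2.1 hab
  have hcb' := hD.2.1 hcb
  by_cases hba : G.Adj b a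
  · by_cases hbc : G.Adj b c
    · exact absurd (isAdjacent_of_mem_representatives hD hac
        (IsLine.mem_chainComponent ⟨hba, hab'⟩) (IsLine.mem_chainComponent ⟨hbc, hcb'⟩) hab hcb) hn
    · exact absurd (h.isAdjacent_of_isArrow_of_isLine ⟨hcb', hbc⟩ ⟨hba, hab'⟩).symm hn
  · exact ⟨⟨hab', hba⟩, hcb', fun hbc =>
      hn (h.isAdjacent_of_isArrow_of_isLine ⟨hab', hba⟩ ⟨hbc, hcb'⟩)⟩

theorem Represents.of_mem_representatives (h : Represents 𝓘 G E) (hD : D ∈ representatives G) :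
    Represents 𝓘 G D := by
  have hadj : ∀ a b, IsAdjacent G a b ↔ IsAdjacent D a b := fun a b =>
    (iff_of_eq (congrFun₂ (congrArg Digraph.Adj hD.2.2.1) a b)).symm
  have adj_of_arrow : ∀ {a b}, IsArrow G a b → D.Adj a b := fun hab =>
    ((hadj _ _).1 (.inl hab.1)).resolve_right fun hba => hab.2 (hD.2.1 hba)
  refine h.of_isVStructure_iff hD.1 hD.2.1 hadj fun a b c => ?_
  rw [h.isVStructure_iff]
  constructor
  · rintro ⟨hab, hcb, hac, hn⟩
    rw [← hadj] at hn
    have harrows := h.isArrow_and_isArrow_of_mem_representatives hD hab hcb hac hn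
    exact ⟨harrows.1, harrows.2, hac, hn⟩
  · rintro ⟨hab, hcb, hac, hn⟩
    exact ⟨adj_of_arrow hab, adj_of_arrow hcb, hac, mt (hadj a c).2 hn⟩

end Representation

section EssentialGraphs

variable {V ι : Type*} [Fintype V] [DecidableEq V] {𝓘 : ι → Finset V} {G : Digraph V}
  {Ω : V → Type*} [∀ i, MeasurableSpace (Ω i)] {μ : ∀ i, Measure (Ω i)} [∀ i, SigmaFinite (μ i)]

theorem IsEssentialGraph.exists_represents (hμ : ∀ i, HasDisjointPositiveSets (μ i))
    (h𝓘 : IsConservative 𝓘) (hG : IsEssentialGraph μ 𝓘 G) : ∃ D, Represents 𝓘 G D := by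
  obtain ⟨D, hD, rfl⟩ := hG
  refine ⟨D, hD, fun a b => ?_⟩
  rw [essentialGraph, Digraph.sSup_adj]
  constructor
  · rintro ⟨E, ⟨hE, hED⟩, hab⟩
    exact ⟨E, hE, (markovEquivalent_iff_graphEquivalent hμ h𝓘 hE hD).1 hED, hab⟩
  · rintro ⟨E, hE, hED, hab⟩
    exact ⟨E, ⟨hE, (markovEquivalent_iff_graphEquivalent hμ h𝓘 hE hD).2 hED⟩, hab⟩

theorem isPartialEssentialGraph_of_graphEquivalent (hμ : ∀ i, μ i ≠ 0) {D H : Digraph V}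
    (hD : IsDAG D) (hDH : D ≤ H)
    (hH : ∀ a b, H.Adj a b → ∃ E, IsDAG E ∧ GraphEquivalent 𝓘 E D ∧ E.Adj a b)
    (hind : ∀ a b c, IsArrow H a b → IsLine H b c → IsAdjacent H a c) :
    IsPartialEssentialGraph μ 𝓘 D H := by
  refine ⟨hD, hDH, fun a b hab => ?_,
    fun ⟨a, b, c, hab, hbc, hac⟩ => hac (hind a b c hab hbc)⟩
  rw [essentialGraph, Digraph.sSup_adj]
  obtain ⟨E, hE, hED, habE⟩ := hH a b hab
  exact ⟨E, ⟨hE, hED.markovEquivalent hμ hE hD⟩, habE⟩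

end EssentialGraphs

/-! ### Reorienting unions of chain components -/

section Saturated

variable {V ι : Type*} {𝓘 : ι → Finset V} {G D E : Digraph V} {S T : Set V} {a b c : V}

/-- `T` is a union of chain components of `G`. -/
def IsSaturated (G : Digraph V) (T : Set V) : Prop := ∀ a ∈ T, chainComponent G a ⊆ T

theorem isSaturated_chainComponent (G : Digraph V) (v : V) : IsSaturated G (chainComponent G v) :=
  fun _ ha _ hb => ⟨ha.1.trans hb.1, hb.2.trans ha.2⟩

theorem IsSaturated.union (hS : IsSaturated G S) (hT : IsSaturated G T) : IsSaturated G (S ∪ T) :=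
  fun a ha => ha.elim (fun ha => (hS a ha).trans Set.subset_union_left)
    fun ha => (hT a ha).trans Set.subset_union_right

theorem IsSaturated.mem_iff (hT : IsSaturated G T) (hab : Precedes G a b) (hba : Precedes G b a) :
    a ∈ T ↔ b ∈ T :=
  ⟨fun ha => hT a ha ⟨hab, hba⟩, fun hb => hT b hb ⟨hba, hab⟩⟩

theorem IsSaturated.mem_iff_of_isLine (hT : IsSaturated G T) (h : IsLine G a b) : a ∈ T ↔ b ∈ T :=
  hT.mem_iff (.single h.1) (.single h.2)

theorem orientAs_le (hEG : E ≤ G) (hDG : D ≤ G) : orientAs E D T ≤ G :=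
  fun _ _ h => h.elim (fun h => hDG h.2.2) fun h => hEG h.2

theorem orientAs_adj_iff_of_notMem_left (ha : a ∉ T) : (orientAs E D T).Adj a b ↔ E.Adj a b := by
  simp [orientAs, ha]

theorem orientAs_adj_iff_of_notMem_right (hb : b ∉ T) : (orientAs E D T).Adj a b ↔ E.Adj a b := by
  simp [orientAs, hb]

theorem IsSaturated.transGen_of_transGen_orientAs (hT : IsSaturated G T) (hEG : E ≤ G)
    (hDG : D ≤ G) (h : Relation.TransGen (orientAs E D T).Adj a b) (hba : Precedes G b a) :
    (a ∈ T → Relation.TransGen D.Adj a b) ∧ (a ∉ T → Relation.TransGen E.Adj a b) := by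
  have adj_of_orientAs : ∀ {a b}, (orientAs E D T).Adj a b → Precedes G b a →
      (a ∈ T ↔ b ∈ T) ∧ (a ∈ T → D.Adj a b) ∧ (a ∉ T → E.Adj a b) := fun {a b} hab hba => by
    have hmem := hT.mem_iff (.single (orientAs_le hEG hDG hab)) hba
    simp only [orientAs] at hab
    tauto
  induction h using Relation.TransGen.head_induction_on with
  | single hab => exact (adj_of_orientAs hab hba).2.imp (.single <| · ·) (.single <| · ·)
  | @head x y hxy hyb ih =>
    have hG : Precedes G y b := Precedes.mono (orientAs_le hEG hDG) hyb.to_reflTransGen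
    obtain ⟨hmem, hD, hE⟩ := adj_of_orientAs hxy (hG.trans hba)
    have ih := ih (hba.tail (orientAs_le hEG hDG hxy))
    exact ⟨fun hx => .head (hD hx) (ih.1 (hmem.1 hx)),
      fun hx => .head (hE hx) (ih.2 (mt hmem.2 hx))⟩

theorem IsSaturated.isDAG_orientAs (hT : IsSaturated G T) (hEG : E ≤ G) (hDG : D ≤ G)
    (hE : IsDAG E) (hD : IsDAG D) : IsDAG (orientAs E D T) := fun a ha => by
  have h := hT.transGen_of_transGen_orientAs hEG hDG ha .refl
  by_cases haT : a ∈ T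
  · exact hD a (h.1 haT)
  · exact hE a (h.2 haT)

namespace Represents

theorem adj_iff_adj_of_not_isLine (hE : Represents 𝓘 G E) (hD : Represents 𝓘 G D)
    (h : ¬ IsLine G a b) : E.Adj a b ↔ D.Adj a b :=
  ⟨fun hab => hD.adj_of_isArrow ⟨hE.le hab, fun hba => h ⟨hE.le hab, hba⟩⟩,
    fun hab => hE.adj_of_isArrow ⟨hD.le hab, fun hba => h ⟨hD.le hab, hba⟩⟩⟩

theorem orientAs_adj_iff_of_mem (hE : Represents 𝓘 G E) (hD : Represents 𝓘 G D)
    (hT : IsSaturated G T) (hb : b ∈ T) : (orientAs E D T).Adj a b ↔ D.Adj a b := by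
  by_cases ha : a ∈ T
  · simp [orientAs, ha, hb]
  · rw [orientAs_adj_iff_of_notMem_left ha]
    exact hE.adj_iff_adj_of_not_isLine hD fun h => ha ((hT.mem_iff_of_isLine h).2 hb)

theorem isAdjacent_orientAs_iff (hE : Represents 𝓘 G E) (hD : Represents 𝓘 G D) (a b : V) :
    IsAdjacent (orientAs E D T) a b ↔ IsAdjacent G a b := by
  by_cases h : a ∈ T ∧ b ∈ T
  · rw [hD.isAdjacent_iff]
    simp only [IsAdjacent, orientAs]
    grind
  · rw [hE.isAdjacent_iff]
    simp only [IsAdjacent, orientAs]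
    grind

protected theorem orientAs (hE : Represents 𝓘 G E) (hD : Represents 𝓘 G D) (hT : IsSaturated G T) :
    Represents 𝓘 G (orientAs E D T) := by
  refine hD.of_isVStructure_iff (hT.isDAG_orientAs hE.le hD.le hE.isDAG hD.isDAG)
    (orientAs_le hE.le hD.le) (fun a b => (hE.isAdjacent_orientAs_iff hD a b).symm) fun a b c => ?_
  by_cases hb : b ∈ T
  · simp only [IsVStructure, hE.orientAs_adj_iff_of_mem hD hT hb, hE.isAdjacent_orientAs_iff hD,
      hD.isAdjacent_iff]
  · rw [hD.isVStructure_iff, ← hE.isVStructure_iff]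
    simp only [IsVStructure, orientAs_adj_iff_of_notMem_right hb, hE.isAdjacent_orientAs_iff hD,
      hE.isAdjacent_iff]

end Represents

/-- The vertices of `T` have the same parents in `E` as in `D`. -/
def ParentsAgreeOn (E D : Digraph V) (T : Set V) : Prop := ∀ b ∈ T, ∀ a, E.Adj a b ↔ D.Adj a b

namespace Represents

theorem exists_parentsAgreeOn (hD : Represents 𝓘 G D) (hT : IsSaturated G T)
    (hab : (orientAs G D T).Adj a b) :
    ∃ E, Represents 𝓘 G E ∧ E.Adj a b ∧ ParentsAgreeOn E D T := by
  rcases hab with ⟨-, -, hab⟩ | ⟨hnT, hab⟩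
  · exact ⟨D, hD, hab, fun _ _ _ => Iff.rfl⟩
  · obtain ⟨E, hE, -, habE⟩ := hD.exists_adj hab
    exact ⟨_, hE.orientAs hD hT, .inr ⟨hnT, habE⟩, fun _ hb _ =>
      hE.orientAs_adj_iff_of_mem hD hT hb⟩

theorem le_orientAs (hD : Represents 𝓘 G D) : D ≤ orientAs G D T := fun a b hab => by
  by_cases h : a ∈ T ∧ b ∈ T
  · exact .inl ⟨h.1, h.2, hab⟩
  · exact .inr ⟨h, hD.le hab⟩

theorem isLine_orientAs (hD : Represents 𝓘 G D) (hT : IsSaturated G T)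
    (h : IsLine (orientAs G D T) b c) : IsLine G b c ∧ b ∉ T ∧ c ∉ T := by
  have hG : IsLine G b c := ⟨orientAs_le le_rfl hD.le h.1, orientAs_le le_rfl hD.le h.2⟩
  have hmem := hT.mem_iff_of_isLine hG
  have hb : b ∉ T := fun hb => by
    have hc := hmem.1 hb
    refine hD.isDAG.not_adj (a := b) (b := c) ?_ ?_
    · simpa [orientAs, hb, hc] using h.1
    · simpa [orientAs, hb, hc] using h.2
  exact ⟨hG, hb, mt hmem.2 hb⟩

theorem orientAs_orientAs (hD : Represents 𝓘 G D) (hS : IsSaturated G S) (hT : IsSaturated G T) :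
    orientAs (orientAs G D S) D T = orientAs G D (S ∪ T) := by
  ext a b
  by_cases hab : IsLine G a b
  · have hS := hS.mem_iff_of_isLine hab
    have hT := hT.mem_iff_of_isLine hab
    simp only [orientAs, Set.mem_union, hS, hT, and_self]
    grind
  · have hGD : G.Adj a b ↔ D.Adj a b :=
      ⟨fun h => hD.adj_of_isArrow ⟨h, fun h' => hab ⟨h, h'⟩⟩, fun h => hD.le h⟩
    simp only [orientAs, hGD]
    grind

end Represents

end Saturated

/-! ### Paths of lines and arrows -/

section Paths

variable {V ι : Type*} {𝓘 : ι → Finset V} {G D E : Digraph V} {T : Set V} {a b c u v x : V}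

/-- The arrows of `G`, without its lines. -/
def arrows (G : Digraph V) : Digraph V where
  Adj := IsArrow G

/-- The lines of `G`, oriented as in `E`. -/
def orientedLines (G E : Digraph V) : Digraph V where
  Adj a b := E.Adj a b ∧ IsLine G a b

theorem orientedLines_le (G E : Digraph V) : orientedLines G E ≤ E := fun _ _ h => h.1

namespace Represents

theorem arrows_le (hD : Represents 𝓘 G D) : arrows G ≤ D := fun _ _ h => hD.adj_of_isArrow h

-- An arrow `a → x` followed by a line `x - y` can be short-cut by an edge from `a` to `y`.
theorem exists_lines_arrows_of_isArrow (hE : Represents 𝓘 G E) (hax : IsArrow G a x)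
    (hxc : Precedes (orientedLines G E) x c) (hcb : Precedes (arrows G) c b) :
    ∃ c, Precedes (orientedLines G E) a c ∧ Precedes (arrows G) c b := by
  induction hxc using Relation.ReflTransGen.head_induction_on with
  | refl => exact ⟨a, .refl, .head hax hcb⟩
  | @head x y hxy hyc ih =>
    have hay := hE.adj_of_isArrow_of_isLine hax hxy.2 hxy.1
    by_cases hya : G.Adj y a
    · exact ⟨c, .head ⟨hay, hE.le hay, hya⟩ hyc, hcb⟩
    · exact ih ⟨hE.le hay, hya⟩

theorem exists_lines_arrows (hE : Represents 𝓘 G E) (h : Precedes E a b) :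
    ∃ c, Precedes (orientedLines G E) a c ∧ Precedes (arrows G) c b := by
  induction h using Relation.ReflTransGen.head_induction_on with
  | refl => exact ⟨b, .refl, .refl⟩
  | @head a x hax _ ih =>
    obtain ⟨c, hxc, hcb⟩ := ih
    by_cases hxa : G.Adj x a
    · exact ⟨c, .head ⟨hax, hE.le hax, hxa⟩ hxc, hcb⟩
    · exact hE.exists_lines_arrows_of_isArrow ⟨hE.le hax, hxa⟩ hxc hcb

theorem precedes_of_parentsAgreeOn (hE : Represents 𝓘 G E) (hD : Represents 𝓘 G D)
    (hT : IsSaturated G T) (hED : ParentsAgreeOn E D T) (ha : a ∈ T) (h : Precedes E a b) :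
    Precedes D a b := by
  obtain ⟨c, hac, hcb⟩ := hE.exists_lines_arrows h
  suffices c ∈ T ∧ Precedes D a c from this.2.trans (hcb.mono hD.arrows_le)
  clear hcb
  induction hac with
  | refl => exact ⟨ha, .refl⟩
  | tail _ hxy ih =>
    have hy := (hT.mem_iff_of_isLine hxy.2).1 ih.1
    exact ⟨hy, ih.2.tail ((hED _ hy _).1 hxy.1)⟩

theorem exists_detour_of_isArrow (hE : Represents 𝓘 G E) (hD : Represents 𝓘 G D)
    (hT : IsSaturated G T) (hED : ParentsAgreeOn E D T) (hu : u ∈ T) (hv : v ∈ T)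
    (hvx : IsArrow G v x) (hxu : x ≠ u)
    (hxc : Precedes (orientedLines G E) x c) (hcu : Precedes (arrows G) c u) :
    ∃ y, D.Adj v y ∧ y ≠ u ∧ Precedes D y u := by
  induction hxc using Relation.ReflTransGen.head_induction_on with
  | refl => exact ⟨c, hD.adj_of_isArrow hvx, hxu, hcu.mono hD.arrows_le⟩
  | @head x y hxy hyc ih =>
    by_cases hyu : y = u
    · subst hyu
      exact ⟨x, hD.adj_of_isArrow hvx, hxu, .single ((hED y hu x).1 hxy.1)⟩
    have hvy := hE.adj_of_isArrow_of_isLine hvx hxy.2 hxy.1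
    by_cases hyv : G.Adj y v
    · have hy : y ∈ T := (hT.mem_iff_of_isLine ⟨hE.le hvy, hyv⟩).1 hv
      have hyu' : Precedes E y u :=
        (Precedes.mono (orientedLines_le G E) hyc).trans (hcu.mono hE.arrows_le)
      exact ⟨y, (hED y hy v).1 hvy, hyu, hE.precedes_of_parentsAgreeOn hD hT hED hy hyu'⟩
    · exact ih ⟨hE.le hvy, hyv⟩ hyu

theorem exists_detour (hE : Represents 𝓘 G E) (hD : Represents 𝓘 G D) (hT : IsSaturated G T)
    (hED : ParentsAgreeOn E D T) (hu : u ∈ T) (hv : v ∈ T) (hvx : E.Adj v x) (hxu : x ≠ u)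
    (h : Precedes E x u) : ∃ y, D.Adj v y ∧ y ≠ u ∧ Precedes D y u := by
  by_cases hxv : G.Adj x v
  · have hx : x ∈ T := (hT.mem_iff_of_isLine ⟨hE.le hvx, hxv⟩).1 hv
    exact ⟨x, (hED x hx v).1 hvx, hxu, hE.precedes_of_parentsAgreeOn hD hT hED hx h⟩
  · obtain ⟨c, hxc, hcu⟩ := hE.exists_lines_arrows h
    exact hE.exists_detour_of_isArrow hD hT hED hu hv ⟨hE.le hvx, hxv⟩ hxu hxc hcu

end Represents

end Paths

/-! ### Inserting, removing and turning an edge -/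

section Steps

variable {V ι : Type*} {𝓘 : ι → Finset V} {G D E : Digraph V} {T : Set V} {u v x y z : V}

theorem GraphEquivalent.of_adj_and_adj_iff (hadj : ∀ a b, IsAdjacent E a b ↔ IsAdjacent D a b)
    (hv : ∀ x y z, x ≠ z → ¬ IsAdjacent D x z →
      (E.Adj x y ∧ E.Adj z y ↔ D.Adj x y ∧ D.Adj z y))
    (hI : ∀ a b, E.Adj a b → D.Adj b a → ∀ j, a ∈ 𝓘 j ↔ b ∈ 𝓘 j) : GraphEquivalent 𝓘 E D where
  isAdjacent_iff := hadj
  isVStructure_iff x y z := by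
    have := hv x y z
    simp only [IsVStructure, hadj]
    tauto
  mem_iff := hI

namespace Represents

theorem isAdjacent_iff_isAdjacent (hE : Represents 𝓘 G E) (hD : Represents 𝓘 G D) (x y : V) :
    IsAdjacent E x y ↔ IsAdjacent D x y :=
  (hE.isAdjacent_iff x y).symm.trans (hD.isAdjacent_iff x y)

theorem mem_iff_of_adj_of_adj (hE : Represents 𝓘 G E) (hD : Represents 𝓘 G D) (hxy : E.Adj x y)
    (hyx : D.Adj y x) (j : ι) : x ∈ 𝓘 j ↔ y ∈ 𝓘 j :=
  hD.mem_iff_of_isLine ⟨hE.le hxy, hD.le hyx⟩ j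

theorem adj_and_adj_iff (hE : Represents 𝓘 G E) (hD : Represents 𝓘 G D) (hxz : x ≠ z)
    (hn : ¬ IsAdjacent D x z) : E.Adj x y ∧ E.Adj z y ↔ D.Adj x y ∧ D.Adj z y := by
  have hv := (hE.isVStructure_iff x y z).trans (hD.isVStructure_iff x y z).symm
  simpa only [IsVStructure, hE.isAdjacent_iff_isAdjacent hD, hxz, hn, ne_eq, not_false_eq_true,
    and_true] using hv

theorem adj_and_adj_iff_of_notMem (hE : Represents 𝓘 G E) (hD : Represents 𝓘 G D)
    (hT : IsSaturated G T) (hv : v ∈ T) (hy : y ∉ T) (huvE : E.Adj u v) (huvD : D.Adj u v) :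
    E.Adj u y ∧ E.Adj v y ↔ D.Adj u y ∧ D.Adj v y := by
  have hvy : E.Adj v y ↔ D.Adj v y :=
    hE.adj_iff_adj_of_not_isLine hD fun h => hy ((hT.mem_iff_of_isLine h).1 hv)
  rw [hvy]
  refine and_congr_left fun h => ?_
  have huy := hE.isAdjacent_iff_isAdjacent hD u y
  rwa [IsAdjacent, IsAdjacent, or_iff_left (hE.isDAG.not_adj_of_adj_of_adj huvE (hvy.2 h)),
    or_iff_left (hD.isDAG.not_adj_of_adj_of_adj huvD h)] at huy

theorem graphEquivalent_addEdge (hE : Represents 𝓘 G E) (hD : Represents 𝓘 G D) (huv : u ≠ v)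
    (hn : ¬ IsAdjacent G u v) (hED : ∀ x, E.Adj x v ↔ D.Adj x v) :
    GraphEquivalent 𝓘 (addEdge E u v) (addEdge D u v) := by
  refine .of_adj_and_adj_iff (fun a b => ?_) (fun x y z hxz hn' => ?_) fun a b hab hba => ?_
  · have := hE.isAdjacent_iff_isAdjacent hD a b
    simp only [IsAdjacent, addEdge] at this ⊢
    grind
  · by_cases hy : y = v
    · simp only [addEdge, hy, hED]
    · have hnD : ¬ IsAdjacent D x z := fun h => hn' (.imp .inl .inl h)
      simpa [addEdge, hy] using hE.adj_and_adj_iff hD hxz hnD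
  · rcases hab with hab | ⟨rfl, rfl⟩ <;> rcases hba with hba | ⟨hbu, hav⟩
    · exact hE.mem_iff_of_adj_of_adj hD hab hba
    · exact absurd (.inr (hbu ▸ hav ▸ hE.le hab)) hn
    · exact absurd (.inr (hD.le hba)) hn
    · exact absurd hbu.symm huv

theorem graphEquivalent_removeEdge (hE : Represents 𝓘 G E) (hD : Represents 𝓘 G D)
    (hT : IsSaturated G T) (hED : ParentsAgreeOn E D T) (hv : v ∈ T) (huv : D.Adj u v) :
    GraphEquivalent 𝓘 (removeEdge E u v) (removeEdge D u v) := by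
  have hadj := hE.isAdjacent_iff_isAdjacent hD
  have huvE : E.Adj u v := (hED v hv u).2 huv
  refine .of_adj_and_adj_iff (fun a b => ?_) (fun x y z hxz hn => ?_)
    fun a b hab hba => hE.mem_iff_of_adj_of_adj hD hab.1 hba.1
  · have := hadj a b
    have := hE.isDAG.not_adj huvE
    have := hD.isDAG.not_adj huv
    simp only [IsAdjacent, removeEdge] at *
    grind
  · by_cases hy : y ∈ T
    · simp only [removeEdge, hED y hy]
    have hyv : y ≠ v := fun h => hy (h ▸ hv)
    simp only [removeEdge, hyv, and_false, not_false_eq_true, and_true]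
    by_cases hxzD : IsAdjacent D x z
    · have hxz : (x = u ∧ z = v) ∨ (x = v ∧ z = u) := by
        simp only [IsAdjacent, removeEdge] at hxzD hn
        grind
      have key := hE.adj_and_adj_iff_of_notMem hD hT hv hy huvE huv
      rcases hxz with ⟨rfl, rfl⟩ | ⟨rfl, rfl⟩
      · exact key
      · rw [and_comm, key, and_comm]
    · exact hE.adj_and_adj_iff hD hxz hxzD

theorem graphEquivalent_turnEdge (hE : Represents 𝓘 G E) (hD : Represents 𝓘 G D)
    (hEDv : ∀ x, E.Adj x v ↔ D.Adj x v) (hEDu : ∀ x, E.Adj x u ↔ D.Adj x u) (hvu : D.Adj v u) :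
    GraphEquivalent 𝓘 (turnEdge E v u) (turnEdge D v u) := by
  have hvuE : E.Adj v u := (hEDu v).2 hvu
  refine .of_adj_and_adj_iff (fun a b => ?_) (fun x y z hxz hn => ?_) fun a b hab hba => ?_
  · rw [isAdjacent_turnEdge_iff hvuE, isAdjacent_turnEdge_iff hvu, hE.isAdjacent_iff_isAdjacent hD]
  · rw [isAdjacent_turnEdge_iff hvu] at hn
    simp only [turnEdge_adj]
    by_cases hyv : y = v
    · simp only [hyv, hEDv]
    by_cases hyu : y = u
    · simp only [hyu, hEDu]
    · simpa [hyv, hyu] using hE.adj_and_adj_iff hD hxz hn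
  · rw [turnEdge_adj] at hab hba
    rcases hab with hab | ⟨rfl, rfl⟩ <;> rcases hba with hba | ⟨hbu, hav⟩
    · exact hE.mem_iff_of_adj_of_adj hD hab.1 hba.1
    · exact absurd ⟨hav, hbu⟩ hab.2
    · exact absurd ⟨rfl, rfl⟩ hba.2
    · exact fun _ => hbu ▸ Iff.rfl

theorem isDAG_turnEdge (hE : Represents 𝓘 G E) (hD : Represents 𝓘 G D) (hT : IsSaturated G T)
    (hED : ParentsAgreeOn E D T) (hu : u ∈ T) (hv : v ∈ T) (hvu : D.Adj v u)
    (hD' : IsDAG (turnEdge D v u)) : IsDAG (turnEdge E v u) := by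
  refine (hE.isDAG.of_le (removeEdge_le E v u)).addEdge fun hvuE => ?_
  rcases Relation.ReflTransGen.cases_head hvuE with rfl | ⟨x, hvx, hxu⟩
  · exact hD.isDAG.not_adj_self _ hvu
  obtain ⟨y, hvy, hyu, hpath⟩ := hE.exists_detour hD hT hED hu hv hvx.1 (fun h => hvx.2 ⟨rfl, h⟩)
    (Precedes.mono (removeEdge_le E v u) hxu)
  -- A path from the child `y` of `v` never returns to `v`, so it avoids the edge `(v, u)`.
  have avoids : ∀ w, Precedes D y w → Precedes (removeEdge D v u) y w := fun w hyw => by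
    induction hyw with
    | refl => exact .refl
    | tail hyw hwz ih => exact ih.tail ⟨hwz, fun h => hD.isDAG v (.head' hvy (h.1 ▸ hyw))⟩
  exact hD'.not_precedes_of_addEdge (.head ⟨hvy, fun h => hyu h.2⟩ (avoids u hpath))

end Represents

end Steps

/-! ### Partial essential graphs of the neighbours of a representative -/

section PartialEssentialGraphs

variable {V ι : Type*} {𝓘 : ι → Finset V} {G D : Digraph V} {T : Set V} {a b c u v : V}

theorem Represents.isAdjacent_of_isArrow_of_isLine_orientAs (hD : Represents 𝓘 G D)
    (hT : IsSaturated G T) (hab : IsArrow (orientAs G D T) a b)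
    (hbc : IsLine (orientAs G D T) b c) : IsAdjacent (orientAs G D T) a c := by
  obtain ⟨hbc, hb, hc⟩ := hD.isLine_orientAs hT hbc
  rw [IsArrow, orientAs_adj_iff_of_notMem_left hb, orientAs_adj_iff_of_notMem_right hb] at hab
  rw [IsAdjacent, orientAs_adj_iff_of_notMem_left hc, orientAs_adj_iff_of_notMem_right hc]
  exact hD.isAdjacent_of_isArrow_of_isLine hab hbc

theorem Represents.not_isLine_orientAs (hD : Represents 𝓘 G D) (hT : IsSaturated G T)
    (h : a ∈ T ∨ b ∈ T) : ¬ IsLine (orientAs G D T) a b := fun hab =>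
  h.elim (hD.isLine_orientAs hT hab).2.1 (hD.isLine_orientAs hT hab).2.2

theorem Represents.not_isArrow_and_isArrow_and_isLine (hD : Represents 𝓘 G D)
    (hab : IsArrow G a b) (hbc : IsArrow G b c) : ¬ IsLine G c a := fun hca => by
  obtain ⟨E, hE, -, hcaE⟩ := hD.exists_adj hca.1
  exact hE.isDAG.not_adj_of_adj_of_adj (hE.adj_of_isArrow hab) (hE.adj_of_isArrow hbc) hcaE

variable [Fintype V] [DecidableEq V] {Ω : V → Type*} [∀ i, MeasurableSpace (Ω i)]
  {μ : ∀ i, Measure (Ω i)} [∀ i, SigmaFinite (μ i)]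

theorem isPartialEssentialGraph_addEdge (hμ : ∀ i, μ i ≠ 0) (hD : Represents 𝓘 G D)
    (hT : IsSaturated G T) (hv : v ∈ T) (huv : u ≠ v) (hn : ¬ IsAdjacent G u v)
    (hD' : IsDAG (addEdge D u v)) :
    IsPartialEssentialGraph μ 𝓘 (addEdge D u v) (addEdge (orientAs G D T) u v) := by
  have hK : orientAs G D T ≤ G := orientAs_le le_rfl hD.le
  refine isPartialEssentialGraph_of_graphEquivalent hμ hD' (fun _ _ => .imp_left (hD.le_orientAs ·))
    ?_ fun a b c hab hbc => ?_
  · rintro a b (hab | hab)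
    · obtain ⟨E, hE, habE, hED⟩ := hD.exists_parentsAgreeOn hT hab
      refine ⟨addEdge E u v, hE.isDAG.addEdge fun hvu => ?_,
        hE.graphEquivalent_addEdge hD huv hn (hED v hv), .inl habE⟩
      exact hD'.not_precedes_of_addEdge (hE.precedes_of_parentsAgreeOn hD hT hED hv hvu)
    · exact ⟨_, hD', .refl hD', .inr hab⟩
  · have hbc' : IsLine (orientAs G D T) b c := by
      rcases hbc with ⟨hbc | ⟨hbu, hcv⟩, hcb | ⟨hcu, hbv⟩⟩
      · exact ⟨hbc, hcb⟩
      · exact absurd (.inr (hcu ▸ hbv ▸ hK hbc)) hn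
      · exact absurd (.inr (hbu ▸ hcv ▸ hK hcb)) hn
      · exact absurd (hbu.symm.trans hbv) huv
    have hbv : b ≠ v := fun h => hD.not_isLine_orientAs hT (.inl (h ▸ hv)) hbc'
    have hab' : IsArrow (orientAs G D T) a b :=
      ⟨hab.1.resolve_right fun h => hbv h.2, fun h => hab.2 (.inl h)⟩
    exact (hD.isAdjacent_of_isArrow_of_isLine_orientAs hT hab' hbc').imp .inl .inl

theorem isPartialEssentialGraph_removeEdge (hμ : ∀ i, μ i ≠ 0) (hD : Represents 𝓘 G D)
    (hT : IsSaturated G T) (hv : v ∈ T) (huv : D.Adj u v) :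
    IsPartialEssentialGraph μ 𝓘 (removeEdge D u v) (removeEdge (orientAs G D T) u v) := by
  have huvK : (orientAs G D T).Adj u v := hD.le_orientAs huv
  refine isPartialEssentialGraph_of_graphEquivalent hμ (hD.isDAG.of_le (removeEdge_le D u v))
    (fun _ _ => .imp_left (hD.le_orientAs ·)) ?_ fun a b c hab hbc => ?_
  · rintro a b ⟨hab, hne⟩
    obtain ⟨E, hE, habE, hED⟩ := hD.exists_parentsAgreeOn hT hab
    exact ⟨removeEdge E u v, hE.isDAG.of_le (removeEdge_le E u v),
      hE.graphEquivalent_removeEdge hD hT hED hv huv, habE, hne⟩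
  · have hbc' : IsLine (orientAs G D T) b c := ⟨hbc.1.1, hbc.2.1⟩
    have hab' : IsArrow (orientAs G D T) a b := by
      refine ⟨hab.1.1, fun hba => hab.2 ⟨hba, ?_⟩⟩
      rintro ⟨rfl, rfl⟩
      exact hD.not_isLine_orientAs hT (.inl hv) ⟨hab.1.1, hba⟩
    obtain ⟨hG, hb, hc⟩ := hD.isLine_orientAs hT hbc'
    refine (hD.isAdjacent_of_isArrow_of_isLine_orientAs hT hab' hbc').imp
      (fun hac => ⟨hac, fun h => hc (h.2 ▸ hv)⟩) fun hca => ⟨hca, ?_⟩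
    rintro ⟨rfl, rfl⟩
    rw [orientAs_adj_iff_of_notMem_left hc] at hca
    rw [IsArrow, orientAs_adj_iff_of_notMem_left hb, orientAs_adj_iff_of_notMem_right hb] at hab'
    refine hD.not_isArrow_and_isArrow_and_isLine ⟨hca, fun hac => ?_⟩ hab' hG
    exact hc ((hT.mem_iff_of_isLine ⟨hca, hac⟩).2 hv)

theorem isPartialEssentialGraph_turnEdge (hμ : ∀ i, μ i ≠ 0) (hD : Represents 𝓘 G D)
    (hT : IsSaturated G T) (hu : u ∈ T) (hv : v ∈ T) (hvu : D.Adj v u)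
    (hD' : IsDAG (turnEdge D v u)) :
    IsPartialEssentialGraph μ 𝓘 (turnEdge D v u) (turnEdge (orientAs G D T) v u) := by
  have hvuK : (orientAs G D T).Adj v u := hD.le_orientAs hvu
  refine isPartialEssentialGraph_of_graphEquivalent hμ hD'
    (fun _ _ => .imp_left <| .imp_left (hD.le_orientAs ·)) ?_ fun a b c hab hbc => ?_
  · rintro a b (⟨hab, hne⟩ | hab)
    · obtain ⟨E, hE, habE, hED⟩ := hD.exists_parentsAgreeOn hT hab
      exact ⟨turnEdge E v u, hE.isDAG_turnEdge hD hT hED hu hv hvu hD',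
        hE.graphEquivalent_turnEdge hD (hED v hv) (hED u hu) hvu, .inl ⟨habE, hne⟩⟩
    · exact ⟨_, hD', .refl hD', .inr hab⟩
  · have hbc' : IsLine (orientAs G D T) b c := by
      rcases hbc with ⟨hbc | ⟨hbu, hcv⟩, hcb | ⟨hcu, hbv⟩⟩
      · exact ⟨hbc.1, hcb.1⟩
      · exact absurd ⟨hbv, hcu⟩ hbc.2
      · exact absurd ⟨hcv, hbu⟩ hcb.2
      · exact absurd (hbv.symm.trans hbu) (hD.isDAG.ne hvu)
    have hbv : b ≠ v := fun h => hD.not_isLine_orientAs hT (.inl (h ▸ hv)) hbc'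
    have hab' : IsArrow (orientAs G D T) a b :=
      ⟨(hab.1.resolve_right fun h => hbv h.2).1, fun h => hab.2 (.inl ⟨h, fun h => hbv h.1⟩)⟩
    rw [isAdjacent_turnEdge_iff hvuK]
    exact hD.isAdjacent_of_isArrow_of_isLine_orientAs hT hab' hbc'

end PartialEssentialGraphs

end IntervGraph

theorem mainTheorem10_general {V ι : Type*} [Fintype V] [DecidableEq V] {Ω : V → Type*}
    [∀ i, MeasurableSpace (Ω i)] (μ : ∀ i, Measure (Ω i)) [∀ i, SigmaFinite (μ i)]
    (hμ : ∀ i, HasDisjointPositiveSets (μ i)) (𝓘 : ι → Finset V) (h𝓘 : IsConservative 𝓘)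
    (G : Digraph V) (hG : IsEssentialGraph μ 𝓘 G) :
    (∀ (u v : V) (D : Digraph V), u ≠ v → ¬ IsAdjacent G u v → D ∈ representatives G →
      IsDAG (addEdge D u v) →
      IsPartialEssentialGraph μ 𝓘 (addEdge D u v)
        (addEdge (orientAs G D (chainComponent G v)) u v)) ∧
    (∀ (u v : V) (D : Digraph V), D ∈ representatives G → D.Adj u v →
      IsPartialEssentialGraph μ 𝓘 (removeEdge D u v)
        (removeEdge (orientAs G D (chainComponent G v)) u v)) ∧
    (∀ (u v : V) (D : Digraph V), IsLine G u v → D ∈ representatives G → D.Adj v u →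
      IsDAG (turnEdge D v u) →
      IsPartialEssentialGraph μ 𝓘 (turnEdge D v u)
        (turnEdge (orientAs G D (chainComponent G v)) v u)) ∧
    (∀ (u v : V) (D : Digraph V), IsArrow G v u → D ∈ representatives G →
      IsDAG (turnEdge D v u) →
      IsPartialEssentialGraph μ 𝓘 (turnEdge D v u)
        (turnEdge (orientAs (orientAs G D (chainComponent G v)) D (chainComponent G u)) v u)) := by
  have hμ' := fun i => (hμ i).ne_zero
  obtain ⟨D₀, hD₀⟩ := hG.exists_represents hμ h𝓘
  have hT := isSaturated_chainComponent G
  have hmem := mem_chainComponent_self G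
  refine ⟨fun u v D huv hn hD hD' => ?_, fun u v D hD huv => ?_, fun u v D huv hD hvu hD' => ?_,
    fun u v D hvu hD hD' => ?_⟩ <;> have hD := hD₀.of_mem_representatives hD
  · exact isPartialEssentialGraph_addEdge hμ' hD (hT v) (hmem v) huv hn hD'
  · exact isPartialEssentialGraph_removeEdge hμ' hD (hT v) (hmem v) huv
  · exact isPartialEssentialGraph_turnEdge hμ' hD (hT v) (IsLine.mem_chainComponent ⟨huv.2, huv.1⟩)
      (hmem v) hvu hD'
  · rw [hD.orientAs_orientAs (hT v) (hT u)]
    exact isPartialEssentialGraph_turnEdge hμ' hD ((hT v).union (hT u)) (.inr (hmem u))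
      (.inl (hmem v)) (hD.adj_of_isArrow hvu) hD'

theorem mainTheorem10 {p : ℕ} {Ω : Fin p → Type*} [∀ i, MeasurableSpace (Ω i)]
    (μ : ∀ i, Measure (Ω i)) [∀ i, SigmaFinite (μ i)]
    (hμ : ∀ i, ∃ A B : Set (Ω i), MeasurableSet A ∧ MeasurableSet B ∧ Disjoint A B ∧
      0 < μ i A ∧ 0 < μ i B)
    {J : ℕ} (𝓘 : Fin J → Finset (Fin p)) (h𝓘 : IsConservative 𝓘)
    (G : Digraph (Fin p)) (hG : IsEssentialGraph μ 𝓘 G) :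
    -- forward step
    (∀ (u v : Fin p) (C : Set (Fin p)) (D D' : Digraph (Fin p)),
      u ≠ v → ¬ IsAdjacent G u v → D ∈ representatives G →
      {a ∈ nb G v | IsArrow D a v} = C →
      D' = addEdge D u v → D' ∈ forwardDAGs G →
      IsPartialEssentialGraph μ 𝓘 D'
        (addEdge (orientAs G D (chainComponent G v)) u v)) ∧
    -- backward step
    (∀ (u v : Fin p) (C : Set (Fin p)) (D D' : Digraph (Fin p)),
      G.Adj u v → D ∈ representatives G → IsArrow D u v →
      {a ∈ nb G v \ {u} | IsArrow D a v} = C →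
      D' = removeEdge D u v → D' ∈ backwardDAGs G →
      IsPartialEssentialGraph μ 𝓘 D'
        (removeEdge (orientAs G D (chainComponent G v)) u v)) ∧
    -- turning step, the edge is a line of `G`
    (∀ (u v : Fin p) (C : Set (Fin p)) (D D' : Digraph (Fin p)),
      IsLine G u v → C ⊆ nb G v \ {u} → D ∈ representatives G → IsArrow D v u →
      {a ∈ nb G v | IsArrow D a v} = C →
      D' = addEdge (removeEdge D v u) u v → D' ∈ turningDAGs G →
      IsPartialEssentialGraph μ 𝓘 D'
        (addEdge (removeEdge (orientAs G D (chainComponent G v)) v u) u v)) ∧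
    -- turning step, the edge is an arrow of `G`
    (∀ (u v : Fin p) (C : Set (Fin p)) (D D' : Digraph (Fin p)),
      IsArrow G v u → D ∈ representatives G →
      {a ∈ nb G v | IsArrow D a v} = C →
      D' = addEdge (removeEdge D v u) u v → D' ∈ turningDAGs G →
      IsPartialEssentialGraph μ 𝓘 D'
        (addEdge (removeEdge (orientAs (orientAs G D (chainComponent G v)) D
          (chainComponent G u)) v u) u v)) := by
  obtain ⟨forward, backward, turnLine, turnArrow⟩ := mainTheorem10_general μ hμ 𝓘 h𝓘 G hG
  refine ⟨?_, ?_, ?_, ?_⟩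
  · rintro u v - D - huv hn hD - rfl hD'
    exact forward u v D huv hn hD hD'.1
  · rintro u v - D - - hD huv - rfl -
    exact backward u v D hD huv.1
  · rintro u v - D - huv - hD hvu - rfl hD'
    exact turnLine u v D huv hD hvu.1 hD'.1
  · rintro u v - D - hvu hD - rfl hD'
    exact turnArrow u v D hvu hD hD'.1
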